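/- An election consists of a finite set $C$ of $m\ge 1$ candidates and a list $V=(v^1,\dots,v^n)$ of $n\ge 1$ voters, each with a total preference order over $C$. For $k\ge 0$ let $s_k(c)$ be the number of voters that rank $c$ in their top $k$ positions, and let the winning round be the smallest $k$ such that $s_k(c)\ge\lfloor n/2\rfloor+1$ for some $c\in C$. The simplified Bucklin winners are the candidates $c$ with $s_k(c)\ge\lfloor n/2\rfloor+1$ for this $k$. An instance of the simplified Bucklin shift bribery problem consists of an election $(C,V)$, a designated candidate $p\in C$, and, for each voter $v^i$, a nondecreasing cost function $\pi^i:\{0,\dots,m\}\to\{0,1,2,\dots\}\cup\{+\infty\}$ with $\pi^i(0)=0$, given by the list of its values (written in binary). A shift action is a vector $\mathbf t=(t_1,\dots,t_n)\in\{0,\dots,m\}^n$; it moves $p$ upwards by $t_i$ positions in the $i$-th preference order for every $i$ (to the top, if $p$ has fewer than $t_i$ candidates above her), keeps the relative order of the other candidates, and costs $\sum_{i=1}^n\pi^i(t_i)$. It is successful if $p$ is a simplified Bucklin winner of the resulting election, and optimal if it is successful and no successful shift action costs less. Theorem. There is an algorithm that, given an instance of the simplified Bucklin shift bribery problem, outputs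 an optimal shift action in time polynomial in the size of the description of the instance. -/

import Mathlib

open scoped BigOperators

/-! ### Elections, the simplified Bucklin rule, shift bribery -/

namespace Bucklin

/-- A total preference order over the candidates `Fin m`, given by the bijection that sends each
candidate to her position; position `0` is the most preferred one, so `rank c = v c + 1`. -/
abbrev Pref (m : ℕ) : Type := Fin m ≃ Fin m

/-- The position of candidate `c` in the preference order `v`, counted from `1`. -/
def rank {m : ℕ} (v : Pref m) (c : Fin m) : ℕ := (v c : ℕ) + 1

/-- An election with `m` candidates and a list of `n` voters. -/
abbrev Election (m n : ℕ) : Type := Fin n → Pref m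

/-- The `k`-Approval score of `c`: the number of voters that rank `c` in the top `k` positions. -/
def score {m n : ℕ} (V : Election m n) (k : ℕ) (c : Fin m) : ℕ :=
  (Finset.univ.filter (fun i : Fin n => rank (V i) c ≤ k)).card

/-- The strict majority threshold `⌊n/2⌋ + 1`. -/
def majority (n : ℕ) : ℕ := n / 2 + 1

/-- The round in which `c` wins: the smallest `k` such that a strict majority of the voters ranks
`c` in the top `k` positions (such a `k` exists as soon as there is a voter). -/
noncomputable def roundOf {m n : ℕ} (V : Election m n) (c : Fin m) : ℕ :=
  sInf {k : ℕ | majority n ≤ score V k c}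

/-- The Bucklin winning round: the minimum of `roundOf V c` over all candidates `c`. -/
noncomputable def winningRound {m n : ℕ} (V : Election m n) : ℕ :=
  ⨅ c : Fin m, roundOf V c

/-- `c` is a simplified Bucklin winner: her score in the Bucklin winning round reaches the strict
majority threshold. -/
def IsWinner {m n : ℕ} (V : Election m n) (c : Fin m) : Prop :=
  majority n ≤ score V (winningRound V) c

/-- What happens to the positions when the candidate in position `r` is shifted upwards by `t`
positions (to the very top if `t` is too large): she moves to position `r - t`, the
candidates that she passes move down by one, and all others stay. -/
def shiftPos {m : ℕ} (r : Fin m) (t : ℕ) (q : Fin m) : Fin m :=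
  if q = r then ⟨(r : ℕ) - t, by omega⟩
  else if h : (r : ℕ) - t ≤ (q : ℕ) ∧ (q : ℕ) < (r : ℕ) then ⟨(q : ℕ) + 1, by omega⟩
  else q

theorem shiftPos_injective {m : ℕ} (r : Fin m) (t : ℕ) :
    Function.Injective (shiftPos r t) := by
  intro a b hab
  unfold shiftPos at hab
  split_ifs at hab <;> simp only [Fin.ext_iff] at * <;> omega

/-- The preference order obtained from `v` by shifting candidate `p` upwards by `t` positions. -/
noncomputable def shiftPref {m : ℕ} (p : Fin m) (t : ℕ) (v : Pref m) : Pref m :=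
  v.trans (Equiv.ofBijective (shiftPos (v p) t)
    (Finite.injective_iff_bijective.mp (shiftPos_injective (v p) t)))

/-- An instance of the shift bribery problem: `m` candidates, a nonempty list of `n` voters with
preference orders, for each voter a nondecreasing cost function on `{0, …, m}` with values in
`ℕ ∪ {∞}` that vanishes at `0`, and a designated candidate `p`. -/
structure ShiftBribery where
  m : ℕ
  n : ℕ
  n_pos : 0 < n
  V : Election m n
  π : Fin n → Fin (m + 1) → ℕ∞
  π_mono : ∀ i, Monotone (π i)
  π_zero : ∀ i, π i 0 = 0
  p : Fin m

namespace ShiftBribery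

/-- Shift actions: for each voter a number of positions in the domain `{0, …, m}` of the cost
functions. -/
abbrev Action (I : ShiftBribery) : Type := Fin I.n → Fin (I.m + 1)

/-- The election after the shift action `t`. -/
noncomputable def shf (I : ShiftBribery) (t : I.Action) : Election I.m I.n :=
  fun i => shiftPref I.p (t i) (I.V i)

/-- The cost of the shift action `t`. -/
noncomputable def cost (I : ShiftBribery) (t : I.Action) : ℕ∞ := ∑ i, I.π i (t i)

/-- `t` makes the designated candidate a simplified Bucklin winner. -/
def Succeeds (I : ShiftBribery) (t : I.Action) : Prop := IsWinner (I.shf t) I.p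

/-- `t` is an optimal shift action. -/
def IsOptimal (I : ShiftBribery) (t : I.Action) : Prop :=
  I.Succeeds t ∧ ∀ s : I.Action, I.Succeeds s → I.cost t ≤ I.cost s

/-- Cost values as natural numbers: `∞` is written as `0` and a finite value `a` as `a + 1`. -/
noncomputable def costCode (a : ℕ∞) : ℕ := if a = ⊤ then 0 else a.toNat + 1

/-- The description of an instance as a list of numbers: `m`, `n`, `p`, and then, voter by voter,
the candidates from the most to the least preferred one and the list of the values of the cost
function at `0, …, m`. -/
noncomputable def encode (I : ShiftBribery) : List ℕ :=
  [I.m, I.n, (I.p : ℕ)] ++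
    (List.ofFn fun i : Fin I.n =>
      (List.ofFn fun q : Fin I.m => (((I.V i).symm q : Fin I.m) : ℕ)) ++
      (List.ofFn fun j : Fin (I.m + 1) => costCode (I.π i j))).flatten

/-- `out` is a correct answer to the instance `I`: it lists the entries of an optimal shift
action. -/
def IsAnswer (I : ShiftBribery) (out : List ℕ) : Prop :=
  ∃ t : I.Action, I.IsOptimal t ∧ out = List.ofFn (fun i => (t i : ℕ))

end ShiftBribery

end Bucklin

/-! ### Random access machines with logarithmic cost, and polynomial time -/

namespace RAM

/-- Memory contents of the machine: registers, arrays (random access memory banks), and the output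
written so far. Every cell holds a natural number. A given program names only finitely many
registers and arrays. -/
structure State where
  reg : ℕ → ℕ
  arr : ℕ → ℕ → ℕ
  out : List ℕ

/-- Set register `x` to `v`. -/
def State.setReg (s : State) (x v : ℕ) : State :=
  ⟨Function.update s.reg x v, s.arr, s.out⟩

/-- Set cell `j` of the array `a` to `v`. -/
def State.setArr (s : State) (a j v : ℕ) : State :=
  ⟨s.reg, Function.update s.arr a (Function.update (s.arr a) j v), s.out⟩

/-- Append `v` to the output. -/
def State.append (s : State) (v : ℕ) : State :=
  ⟨s.reg, s.arr, s.out ++ [v]⟩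

/-- Arithmetic expressions: constants, registers, indirect access `a[e]` to the array `a`, sum,
truncated difference and product. -/
inductive Expr : Type
  | const (v : ℕ) : Expr
  | reg (x : ℕ) : Expr
  | load (a : ℕ) (e : Expr) : Expr
  | add (e f : Expr) : Expr
  | sub (e f : Expr) : Expr
  | mul (e f : Expr) : Expr

/-- The value of an expression. -/
def Expr.eval (s : State) : Expr → ℕ
  | .const v => v
  | .reg x => s.reg x
  | .load a e => s.arr a (e.eval s)
  | .add e f => e.eval s + f.eval s
  | .sub e f => e.eval s - f.eval s
  | .mul e f => e.eval s * f.eval s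

/-- The logarithmic cost of evaluating an expression: every node, array addresses included, is
charged `1` plus the binary length of its value. -/
def Expr.cost (s : State) : Expr → ℕ
  | .const v => 1 + Nat.size v
  | .reg x => 1 + Nat.size (s.reg x)
  | .load a e => e.cost s + (1 + Nat.size (s.arr a (e.eval s)))
  | .add e f => e.cost s + f.cost s + (1 + Nat.size (e.eval s + f.eval s))
  | .sub e f => e.cost s + f.cost s + (1 + Nat.size (e.eval s - f.eval s))
  | .mul e f => e.cost s + f.cost s + (1 + Nat.size (e.eval s * f.eval s))

/-- Programs: assignment to a register, assignment `a[e] := f` to an array cell, output of a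
number, sequential composition, branching (on "nonzero") and loops (while "nonzero"). -/
inductive Prog : Type
  | skip : Prog
  | assign (x : ℕ) (e : Expr) : Prog
  | store (a : ℕ) (e f : Expr) : Prog
  | write (e : Expr) : Prog
  | seq (c d : Prog) : Prog
  | branch (e : Expr) (c d : Prog) : Prog
  | loop (e : Expr) (c : Prog) : Prog

/-- `Exec c s s' T`: started in `s`, the program `c` halts in `s'`, after time exactly `T`. -/
inductive Exec : Prog → State → State → ℕ → Prop
  | skip (s : State) : Exec .skip s s 1
  | assign (x : ℕ) (e : Expr) (s : State) :
      Exec (.assign x e) s (s.setReg x (e.eval s)) (1 + e.cost s)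
  | store (a : ℕ) (e f : Expr) (s : State) :
      Exec (.store a e f) s
        (s.setArr a (e.eval s) (f.eval s))
        (1 + e.cost s + f.cost s)
  | write (e : Expr) (s : State) :
      Exec (.write e) s (s.append (e.eval s)) (1 + e.cost s)
  | seq {c d : Prog} {s s' s'' : State} {T T' : ℕ} :
      Exec c s s' T → Exec d s' s'' T' → Exec (.seq c d) s s'' (1 + T + T')
  | branch_true {e : Expr} {c d : Prog} {s s' : State} {T : ℕ} :
      e.eval s ≠ 0 → Exec c s s' T → Exec (.branch e c d) s s' (1 + e.cost s + T)
  | branch_false {e : Expr} {c d : Prog} {s s' : State} {T : ℕ} :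
      e.eval s = 0 → Exec d s s' T → Exec (.branch e c d) s s' (1 + e.cost s + T)
  | loop_stop {e : Expr} {c : Prog} {s : State} :
      e.eval s = 0 → Exec (.loop e c) s s (1 + e.cost s)
  | loop_step {e : Expr} {c : Prog} {s s' s'' : State} {T T' : ℕ} :
      e.eval s ≠ 0 → Exec c s s' T → Exec (.loop e c) s' s'' T' →
      Exec (.loop e c) s s'' (1 + e.cost s + T + T')

/-- The initial state on input `x`: the input is in array `0`, its length in register `0`;
everything else is `0` and the output is empty. -/
def init (x : List ℕ) : State where
  reg := fun r => if r = 0 then x.length else 0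
  arr := fun a j => if a = 0 then x.getD j 0 else 0
  out := []

/-- The size of an input: the total binary length of its entries, plus one for each entry. -/
def inputSize (x : List ℕ) : ℕ := (x.map fun a => Nat.size a + 1).sum

/-- The search problem "given `a`, find an output `y` with `R a y`", with instances described by
`enc`, is solvable in polynomial time: there is one program that on every instance halts with a
correct output, in time bounded by a polynomial in the size of the description. -/
def SolvableInPolyTime {α : Type} (enc : α → List ℕ) (R : α → List ℕ → Prop) : Prop :=
  ∃ (c : Prog) (P : Polynomial ℕ), ∀ a : α, ∃ (s : State) (T : ℕ),
    Exec c (init (enc a)) s T ∧ T ≤ P.eval (inputSize (enc a)) ∧ R a s.out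

end RAM

/-! Two observations make the problem tractable. By `isWinner_iff`, `p` wins if and only if for some
`κ < m` she has a majority within the top `κ + 1` positions while no other candidate has one within
the top `κ`. Fix `κ`. In a single vote, shifting `p` can push at most one candidate out of the top
`κ`, namely the one on the last of these positions, and does so exactly when `p` enters the top `κ`
from below (`score_shf_of_ne`). Group the votes by the candidate on that position. The constraint
for `c` then depends only on the shifts in the group of `c`, and the groups interact only through
the total number of supporters of `p`.

Hence a dynamic program treats the groups one after another, with two bounded state variables: the
supporters still missing and the votes that the current candidate may still collect before reaching
the majority. Violated constraints cost a penalty larger than every total weight, so a value below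
the penalty is the weight of an action that satisfies all constraints. `Data.value_le` and
`Data.exists_of_value_lt` are the two halves of correctness, and minimizing over `κ` gives
`exists_minValue`.

Infinite costs become a finite number larger than the cost of every action of finite cost
(`isOptimal_of_finiteCost`). An optimal action is found without tracing back: with `L` the input
length, the program is run once with the costs and once with each cost multiplied by `L ^ L` and `t
* L ^ (L - 1 - i)` added for shifting by `t` in vote `i`. The second minimum minus `L ^ L` times the
first is the base `L` code of an optimal action (`exists_optimal_of_isMinWeight`), and its digits
are the output.

Polynomial time comes from a restricted language: every loop runs for exactly the input length, and
products have that length as a factor. Binary lengths then grow by polynomial amounts only, so every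
well-formed program is polynomial (`exec_toProg`), and only functional correctness has to be
verified for the concrete algorithm. -/

namespace RAM

/-! ### Structured programs with bounded loops, and what they leave unchanged -/

/-- Structured programs: every loop runs its counter `x` from `0` up to the value of register
`0`, which holds the length of the input and is never overwritten. -/
inductive Cmd : Type
  | skip : Cmd
  | assign (x : ℕ) (e : Expr) : Cmd
  | store (a : ℕ) (e f : Expr) : Cmd
  | write (e : Expr) : Cmd
  | seq (c d : Cmd) : Cmd
  | ite (e : Expr) (c d : Cmd) : Cmd
  | forL (x : ℕ) (c : Cmd) : Cmd

namespace Cmd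

/-- The machine program of a structured program. -/
def toProg : Cmd → Prog
  | skip => .skip
  | assign x e => .assign x e
  | store a e f => .store a e f
  | write e => .write e
  | seq c d => .seq c.toProg d.toProg
  | ite e c d => .branch e c.toProg d.toProg
  | forL x c => .seq (.assign x (.const 0))
      (.loop (.sub (.reg 0) (.reg x))
        (.seq c.toProg (.assign x (.add (.reg x) (.const 1)))))

/-- The state after `k` rounds of a loop with counter `x` and body semantics `f`. -/
def iter (x : ℕ) (f : State → State) (s : State) : ℕ → State
  | 0 => s.setReg x 0
  | k + 1 => (f (iter x f s k)).setReg x (k + 1)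

/-- The functional semantics of structured programs. -/
def run : Cmd → State → State
  | skip, s => s
  | assign x e, s => s.setReg x (e.eval s)
  | store a e f, s => s.setArr a (e.eval s) (f.eval s)
  | write e, s => s.append (e.eval s)
  | seq c d, s => d.run (c.run s)
  | ite e c d, s => if e.eval s ≠ 0 then c.run s else d.run s
  | forL x c, s => iter x c.run s (s.reg 0)

/-- Whether register `y` is a target of an assignment. -/
def writesReg : Cmd → ℕ → Bool
  | skip, _ => false
  | assign x _, y => x == y
  | store _ _ _, _ => false
  | write _, _ => false
  | seq c d, y => c.writesReg y || d.writesReg y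
  | ite _ c d, y => c.writesReg y || d.writesReg y
  | forL x c, y => x == y || c.writesReg y

/-- Whether array `b` is a target of a store. -/
def writesArr : Cmd → ℕ → Bool
  | skip, _ => false
  | assign _ _, _ => false
  | store a _ _, b => a == b
  | write _, _ => false
  | seq c d, b => c.writesArr b || d.writesArr b
  | ite _ c d, b => c.writesArr b || d.writesArr b
  | forL _ c, b => c.writesArr b

/-- Whether the program can write to the output. -/
def writesOut : Cmd → Bool
  | skip => false
  | assign _ _ => false
  | store _ _ _ => false
  | write _ => true
  | seq c d => c.writesOut || d.writesOut
  | ite _ c d => c.writesOut || d.writesOut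
  | forL _ c => c.writesOut

end Cmd

/-- Expressions in which products are only taken with register `0`. -/
def Expr.linear : Expr → Bool
  | .const _ => true
  | .reg _ => true
  | .load _ e => e.linear
  | .add e f => e.linear && f.linear
  | .sub e f => e.linear && f.linear
  | .mul (.reg 0) f => f.linear
  | .mul _ _ => false

/-- Size of an expression, constants counted in unary. -/
def Expr.nodes : Expr → ℕ
  | .const v => v + 1
  | .reg _ => 1
  | .load _ e => e.nodes + 1
  | .add e f => e.nodes + f.nodes + 1
  | .sub e f => e.nodes + f.nodes + 1
  | .mul e f => e.nodes + f.nodes + 1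

namespace Cmd

/-- Well-formedness: linear expressions, register `0` is constant and loop counters are only
changed by their loops. -/
def wf : Cmd → Bool
  | skip => true
  | assign x e => x != 0 && e.linear
  | store _ e f => e.linear && f.linear
  | write e => e.linear
  | seq c d => c.wf && d.wf
  | ite e c d => e.linear && c.wf && d.wf
  | forL x c => x != 0 && !c.writesReg x && c.wf

theorem writesReg_zero {c : Cmd} (h : c.wf = true) : c.writesReg 0 = false := by
  induction c <;> simp_all [wf, writesReg]

/-- Its hypothesis is a computable syntactic check, so for concrete programs such frame facts follow
by `rfl`. -/
theorem run_reg {c : Cmd} {y : ℕ} (h : c.writesReg y = false) (s : State) :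
    (c.run s).reg y = s.reg y := by
  induction c generalizing s with
  | skip => rfl
  | assign x e =>
    simp only [writesReg, beq_eq_false_iff_ne, ne_eq] at h
    simp [run, State.setReg, Function.update_of_ne (Ne.symm h)]
  | store a e f => rfl
  | write e => rfl
  | seq c d ihc ihd =>
    simp only [writesReg, Bool.or_eq_false_iff] at h
    rw [run, ihd h.2, ihc h.1]
  | ite e c d ihc ihd =>
    simp only [writesReg, Bool.or_eq_false_iff] at h
    rw [run]; split_ifs
    · exact ihc h.1 s
    · exact ihd h.2 s
  | forL x c ih =>
    simp only [writesReg, Bool.or_eq_false_iff, beq_eq_false_iff_ne, ne_eq] at h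
    rw [run]
    generalize s.reg 0 = k
    induction k with
    | zero => simp [iter, State.setReg, Function.update_of_ne (Ne.symm h.1)]
    | succ k ihk =>
      simp only [iter, State.setReg, Function.update_of_ne (Ne.symm h.1)]
      rw [ih h.2, ihk]

theorem run_arr {c : Cmd} {b : ℕ} (h : c.writesArr b = false) (s : State) :
    (c.run s).arr b = s.arr b := by
  induction c generalizing s with
  | skip => rfl
  | assign x e => rfl
  | store a e f =>
    simp only [writesArr, beq_eq_false_iff_ne, ne_eq] at h
    simp [run, State.setArr, Function.update_of_ne (Ne.symm h)]
  | write e => rfl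
  | seq c d ihc ihd =>
    simp only [writesArr, Bool.or_eq_false_iff] at h
    rw [run, ihd h.2, ihc h.1]
  | ite e c d ihc ihd =>
    simp only [writesArr, Bool.or_eq_false_iff] at h
    rw [run]; split_ifs
    · exact ihc h.1 s
    · exact ihd h.2 s
  | forL x c ih =>
    simp only [writesArr] at h
    rw [run]
    generalize s.reg 0 = k
    induction k with
    | zero => rfl
    | succ k ihk => exact (ih h _).trans ihk

theorem run_out {c : Cmd} (h : c.writesOut = false) (s : State) :
    (c.run s).out = s.out := by
  induction c generalizing s with
  | skip => rfl
  | assign x e => rfl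
  | store a e f => rfl
  | write e => simp [writesOut] at h
  | seq c d ihc ihd =>
    simp only [writesOut, Bool.or_eq_false_iff] at h
    rw [run, ihd h.2, ihc h.1]
  | ite e c d ihc ihd =>
    simp only [writesOut, Bool.or_eq_false_iff] at h
    rw [run]; split_ifs
    · exact ihc h.1 s
    · exact ihd h.2 s
  | forL x c ih =>
    simp only [writesOut] at h
    rw [run]
    generalize s.reg 0 = k
    induction k with
    | zero => rfl
    | succ k ihk => exact (ih h _).trans ihk

theorem run_reg_zero {c : Cmd} (h : c.wf = true) (s : State) : (c.run s).reg 0 = s.reg 0 :=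
  run_reg (writesReg_zero h) s

theorem iter_counter (x : ℕ) (f : State → State) (s : State) (k : ℕ) :
    (iter x f s k).reg x = k := by
  cases k <;> simp [iter, State.setReg]

theorem iter_reg {x y : ℕ} {c : Cmd} (hxy : y ≠ x) (h : c.writesReg y = false) (s : State)
    (k : ℕ) : (iter x c.run s k).reg y = s.reg y := by
  induction k with
  | zero => simp [iter, State.setReg, Function.update_of_ne hxy]
  | succ k ihk =>
    simp only [iter, State.setReg, Function.update_of_ne hxy]
    rw [run_reg h, ihk]

theorem iter_arr {x b : ℕ} {c : Cmd} (h : c.writesArr b = false) (s : State)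
    (k : ℕ) : (iter x c.run s k).arr b = s.arr b := by
  induction k with
  | zero => rfl
  | succ k ihk => exact (run_arr h _).trans ihk

theorem iter_out {x : ℕ} {c : Cmd} (h : c.writesOut = false) (s : State)
    (k : ℕ) : (iter x c.run s k).out = s.out := by
  induction k with
  | zero => rfl
  | succ k ihk => exact (run_out h _).trans ihk

/-- `s'` agrees with `s` on everything that `c` and the counter `x` leave untouched. -/
structure Frame (c : Cmd) (x : ℕ) (s s' : State) : Prop where
  reg : ∀ y, y ≠ x → c.writesReg y = false → s'.reg y = s.reg y
  arr : ∀ a, c.writesArr a = false → s'.arr a = s.arr a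
  out : c.writesOut = false → s'.out = s.out

/-- The invariant rule for loops. -/
theorem forL_induction {c : Cmd} {x : ℕ} {s : State} (I : ℕ → State → Prop)
    (base : I 0 (s.setReg x 0))
    (step : ∀ k < s.reg 0, ∀ s', s'.reg x = k → Frame c x s s' → I k s' →
      I (k + 1) ((c.run s').setReg x (k + 1))) :
    I (s.reg 0) ((forL x c).run s) := by
  rw [run]
  have key : ∀ k ≤ s.reg 0, I k (iter x c.run s k) := by
    intro k
    induction k with
    | zero => intro _; exact base
    | succ k ih =>
      intro hk
      exact step k hk _ (iter_counter x _ s k)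
        ⟨fun y hy h => iter_reg hy h s k, fun a h => iter_arr h s k, fun h => iter_out h s k⟩
        (ih (Nat.le_of_succ_le hk))
  exact key _ le_rfl

end Cmd

/-! ### Running times -/

/-- All numbers in the memory have binary length at most `B`. -/
def Bounded (s : State) (B : ℕ) : Prop :=
  (∀ x, Nat.size (s.reg x) ≤ B) ∧ ∀ a j, Nat.size (s.arr a j) ≤ B

theorem Bounded.mono {s : State} {B B' : ℕ} (h : Bounded s B) (hB : B ≤ B') : Bounded s B' :=
  ⟨fun x => (h.1 x).trans hB, fun a j => (h.2 a j).trans hB⟩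

theorem Bounded.setReg {s : State} {B : ℕ} (h : Bounded s B) (x : ℕ) {v : ℕ}
    (hv : Nat.size v ≤ B) : Bounded (s.setReg x v) B := by
  refine ⟨fun y => ?_, h.2⟩
  by_cases hy : y = x
  · subst hy; simpa [State.setReg] using hv
  · simpa [State.setReg, hy] using h.1 y

theorem Bounded.setArr {s : State} {B : ℕ} (h : Bounded s B) (a j : ℕ) {v : ℕ}
    (hv : Nat.size v ≤ B) : Bounded (s.setArr a j v) B := by
  refine ⟨h.1, fun b i => ?_⟩
  by_cases hb : b = a
  · subst hb
    by_cases hi : i = j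
    · subst hi; simpa [State.setArr] using hv
    · simpa [State.setArr, hi] using h.2 b i
  · simpa [State.setArr, hb] using h.2 b i

theorem size_le_self (n : ℕ) : Nat.size n ≤ n := Nat.size_le.2 n.lt_two_pow_self

/-- A sum adds at most one bit, and a product with register `0` adds at most `Y` bits because `s.reg
0 ≤ Y ≤ 2 ^ Y`. So lengths grow additively, whereas iterated squaring would double them in every
round. Constants are counted in unary by `nodes`, which makes their length harmless. -/
theorem Expr.size_eval_le {s : State} {B Y : ℕ} (hs : Bounded s B) (hY : s.reg 0 ≤ Y)
    {e : Expr} (he : e.linear = true) : Nat.size (e.eval s) ≤ B + e.nodes * (Y + 1) := by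
  have step : ∀ u v B', Nat.size u ≤ B' → Nat.size v ≤ B' → Nat.size (u + v) ≤ B' + 1 := by
    intro u v B' hu hv
    rw [Nat.size_le] at *
    rw [pow_succ]; omega
  induction e with
  | const v =>
    have := size_le_self v
    simp only [eval, nodes]
    nlinarith [Nat.zero_le (v * Y)]
  | reg x => simp only [eval, nodes]; have := hs.1 x; omega
  | load a e _ =>
    simp only [eval, nodes]
    exact (hs.2 a _).trans (Nat.le_add_right _ _)
  | add e f ihe ihf =>
    simp only [linear, Bool.and_eq_true] at he
    have h1 := ihe he.1
    have h2 := ihf he.2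
    refine (step _ _ (B + (e.nodes + f.nodes) * (Y + 1)) (h1.trans ?_) (h2.trans ?_)).trans ?_
    · gcongr; omega
    · gcongr; omega
    · simp only [nodes]; nlinarith
  | sub e f ihe ihf =>
    simp only [linear, Bool.and_eq_true] at he
    simp only [eval, nodes]
    refine (Nat.size_le_size (Nat.sub_le _ _)).trans ((ihe he.1).trans ?_)
    gcongr; omega
  | mul e f _ ihf =>
    obtain ⟨rfl, hf⟩ : e = .reg 0 ∧ f.linear = true := by
      unfold linear at he; split at he <;> simp_all
    have h := ihf hf
    simp only [eval, nodes]
    rw [Nat.size_le] at *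
    calc s.reg 0 * f.eval s < 2 ^ Y * 2 ^ (B + f.nodes * (Y + 1)) := by
          refine Nat.mul_lt_mul_of_le_of_lt ?_ h (by positivity)
          exact (hY.trans (Nat.lt_two_pow_self).le)
      _ = 2 ^ (Y + (B + f.nodes * (Y + 1))) := (pow_add _ _ _).symm
      _ ≤ _ := Nat.pow_le_pow_right (by norm_num) (by nlinarith)

theorem Expr.cost_le {s : State} {B Y : ℕ} (hs : Bounded s B) (hY : s.reg 0 ≤ Y)
    {e : Expr} (he : e.linear = true) :
    e.cost s ≤ e.nodes * (1 + B + e.nodes * (Y + 1)) := by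
  -- The length bound for a subexpression involves its own number of nodes; a common bound `N` makes
  -- the estimate additive over the nodes.
  suffices h : ∀ N, e.nodes ≤ N → e.cost s ≤ e.nodes * (1 + B + N * (Y + 1)) from h _ le_rfl
  intro N
  induction e with
  | const v =>
    intro hN
    have := size_le_self v
    simp only [cost, nodes] at *
    nlinarith [Nat.zero_le (v * B), Nat.zero_le (v * (N * (Y + 1))), Nat.zero_le (N * (Y + 1))]
  | reg x =>
    intro hN
    have := hs.1 x
    simp only [cost, nodes] at *
    nlinarith [Nat.zero_le (N * (Y + 1))]
  | load a e ih =>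
    intro hN
    simp only [nodes, linear] at *
    have h1 := ih he (by omega)
    have h2 := hs.2 a (e.eval s)
    simp only [cost]
    nlinarith [Nat.zero_le (N * (Y + 1))]
  | add e f ihe ihf =>
    intro hN
    have h3 := Expr.size_eval_le hs hY he
    simp only [nodes, linear, Bool.and_eq_true, eval] at *
    have h1 := ihe he.1 (by omega)
    have h2 := ihf he.2 (by omega)
    have h4 := Nat.mul_le_mul_right (Y + 1) hN
    simp only [cost]
    linarith
  | sub e f ihe ihf =>
    intro hN
    have h3 := Expr.size_eval_le hs hY he
    simp only [nodes, linear, Bool.and_eq_true, eval] at *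
    have h1 := ihe he.1 (by omega)
    have h2 := ihf he.2 (by omega)
    have h4 := Nat.mul_le_mul_right (Y + 1) hN
    simp only [cost]
    linarith
  | mul e f ihe ihf =>
    intro hN
    have h3 := Expr.size_eval_le hs hY he
    obtain ⟨rfl, hf⟩ : e = .reg 0 ∧ f.linear = true := by
      unfold linear at he; split at he <;> simp_all
    simp only [nodes, eval] at *
    have h1 := ihe rfl (by omega)
    have h2 := ihf hf (by omega)
    have h4 := Nat.mul_le_mul_right (Y + 1) hN
    rw [cost]
    simp only [eval]
    linarith

namespace Cmd

open Polynomial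

/-- How much the binary length of the numbers in memory can grow. -/
noncomputable def growth : Cmd → ℕ[X]
  | skip => 0
  | assign _ e => (e.nodes : ℕ[X]) * (X + 1)
  | store _ _ f => (f.nodes : ℕ[X]) * (X + 1)
  | write _ => 0
  | seq c d => c.growth + d.growth
  | ite _ c d => c.growth + d.growth
  | forL _ c => X + X * c.growth

/-- Upper bound for the cost of evaluating `e` if numbers in memory have length at most `B`. -/
noncomputable def exprTime (e : Expr) (B : ℕ[X]) : ℕ[X] :=
  (e.nodes : ℕ[X]) * (1 + B + (e.nodes : ℕ[X]) * (X + 1))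

/-- Upper bound for the running time if numbers in memory have length at most `B` initially. -/
noncomputable def time : Cmd → ℕ[X] → ℕ[X]
  | skip, _ => 1
  | assign _ e, B => 1 + exprTime e B
  | store _ e f, B => 1 + exprTime e B + exprTime f B
  | write e, B => 1 + exprTime e B
  | seq c d, B => 1 + c.time B + d.time (B + c.growth)
  | ite e c d, B => 1 + exprTime e B + (c.time B + d.time B)
  | forL x c, B => 1 + (1 + exprTime (.const 0) B) +
      (X + 1) * (1 + exprTime (.sub (.reg 0) (.reg x)) (B + (X + X * c.growth)) +
        (1 + c.time (B + (X + X * c.growth)) +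
          (1 + exprTime (.add (.reg x) (.const 1)) (B + (X + X * c.growth) + c.growth))))

/-- Each round contributes at most `G` bits; the summand `Y` leaves room for the counter, which
never exceeds `Y`. -/
theorem bounded_iter {c : Cmd} {x : ℕ} (hx : x ≠ 0) (hc : c.writesReg 0 = false) {s : State}
    {Y B G : ℕ} (hG : ∀ (s' : State) (B' : ℕ), s'.reg 0 ≤ Y → Bounded s' B' →
      Bounded (c.run s') (B' + G)) (hY : s.reg 0 ≤ Y) (hs : Bounded s B) :
    ∀ k ≤ Y, Bounded (iter x c.run s k) (B + Y + k * G) := by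
  intro k
  induction k with
  | zero =>
    intro _
    exact (hs.mono (by omega)).setReg x (by simp)
  | succ k ihk =>
    intro hk
    have h0 : (iter x c.run s k).reg 0 ≤ Y := by rwa [iter_reg (Ne.symm hx) hc]
    refine ((hG _ _ h0 (ihk (by omega))).mono (by rw [add_one_mul]; omega)).setReg x ?_
    exact (size_le_self _).trans (by omega)

theorem bounded_run {c : Cmd} (hc : c.wf = true) {s : State} {Y B : ℕ} (hY : s.reg 0 ≤ Y)
    (hs : Bounded s B) : Bounded (c.run s) (B + c.growth.eval Y) := by
  induction c generalizing s B with
  | skip => simpa [run, growth] using hs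
  | assign x e =>
    simp only [wf, Bool.and_eq_true] at hc
    have h := Expr.size_eval_le hs hY hc.2
    simp only [run, growth, eval_mul, eval_natCast, eval_add, eval_X, eval_one]
    exact (hs.mono (Nat.le_add_right _ _)).setReg _ h
  | store a e f =>
    simp only [wf, Bool.and_eq_true] at hc
    have h := Expr.size_eval_le hs hY hc.2
    simp only [run, growth, eval_mul, eval_natCast, eval_add, eval_X, eval_one]
    exact (hs.mono (Nat.le_add_right _ _)).setArr _ _ h
  | write e =>
    simp only [growth, eval_zero, add_zero]
    exact hs
  | seq c d ihc ihd =>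
    simp only [wf, Bool.and_eq_true] at hc
    have h1 := ihc hc.1 hY hs
    have h2 := ihd hc.2 (s := c.run s) (by rwa [run_reg_zero hc.1]) h1
    simpa only [run, growth, eval_add, add_assoc] using h2
  | ite e c d ihc ihd =>
    simp only [wf, Bool.and_eq_true] at hc
    simp only [run, growth, eval_add]
    split_ifs
    · exact (ihc hc.1.2 hY hs).mono (by omega)
    · exact (ihd hc.2 hY hs).mono (by omega)
  | forL x c ih =>
    simp only [wf, Bool.and_eq_true, bne_iff_ne, Bool.not_eq_true'] at hc
    simp only [run, growth, eval_add, eval_mul, eval_X]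
    refine (bounded_iter hc.1.1 (writesReg_zero hc.2) (fun _ _ h h' => ih hc.2 h h') hY hs _
      hY).mono ?_
    have := Nat.mul_le_mul_right (c.growth.eval Y) hY
    omega

theorem cost_le_exprTime {s : State} {Y : ℕ} {B : ℕ[X]} (hs : Bounded s (B.eval Y))
    (hY : s.reg 0 ≤ Y) {e : Expr} (he : e.linear = true) : e.cost s ≤ (exprTime e B).eval Y := by
  simpa [exprTime] using Expr.cost_le hs hY he

/-- A well-formed structured program computes its functional semantics in polynomial time. -/
theorem exec_toProg {c : Cmd} (hc : c.wf = true) {s : State} {Y : ℕ} {B : ℕ[X]}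
    (hY : s.reg 0 ≤ Y) (hs : Bounded s (B.eval Y)) :
    ∃ T, Exec c.toProg s (c.run s) T ∧ T ≤ (c.time B).eval Y := by
  induction c generalizing s B with
  | skip => exact ⟨1, .skip s, by simp [time]⟩
  | assign x e =>
    simp only [wf, Bool.and_eq_true] at hc
    refine ⟨_, .assign x e s, ?_⟩
    have := cost_le_exprTime hs hY hc.2
    simpa [time] using this
  | store a e f =>
    simp only [wf, Bool.and_eq_true] at hc
    refine ⟨_, .store a e f s, ?_⟩
    have h1 := cost_le_exprTime hs hY hc.1
    have h2 := cost_le_exprTime hs hY hc.2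
    simp only [time, eval_add, eval_one]; omega
  | write e =>
    refine ⟨_, .write e s, ?_⟩
    have := cost_le_exprTime hs hY hc
    simpa [time] using this
  | seq c d ihc ihd =>
    simp only [wf, Bool.and_eq_true] at hc
    obtain ⟨T, hT, hT'⟩ := ihc hc.1 hY hs
    obtain ⟨U, hU, hU'⟩ := ihd hc.2 (s := c.run s) (B := B + c.growth)
      (by rwa [run_reg_zero hc.1]) (by rw [eval_add]; exact bounded_run hc.1 hY hs)
    refine ⟨_, .seq hT hU, ?_⟩
    simp only [time, eval_add, eval_one]; omega
  | ite e c d ihc ihd =>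
    simp only [wf, Bool.and_eq_true] at hc
    have he := cost_le_exprTime hs hY hc.1.1
    simp only [run, time, eval_add, eval_one]
    split_ifs with h
    · obtain ⟨T, hT, hT'⟩ := ihc hc.1.2 hY hs
      exact ⟨_, .branch_true h hT, by omega⟩
    · obtain ⟨T, hT, hT'⟩ := ihd hc.2 hY hs
      exact ⟨_, .branch_false (not_not.1 h) hT, by omega⟩
  | forL x c ih =>
    simp only [wf, Bool.and_eq_true, bne_iff_ne, Bool.not_eq_true'] at hc
    obtain ⟨⟨hx, hcx⟩, hwf⟩ := hc
    set B' : ℕ[X] := B + (X + X * c.growth) with hB'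
    -- The cost of one full round: test, body and increment. It also covers the final failing test.
    set U : ℕ := 1 + (exprTime (.sub (.reg 0) (.reg x)) B').eval Y + (1 + (c.time B').eval Y +
      (1 + (exprTime (.add (.reg x) (.const 1)) (B' + c.growth)).eval Y)) with hU
    have h0 : ∀ k, (iter x c.run s k).reg 0 = s.reg 0 := fun k =>
      iter_reg (Ne.symm hx) (writesReg_zero hwf) s k
    have hbd : ∀ k ≤ s.reg 0, Bounded (iter x c.run s k) (B'.eval Y) := by
      intro k hk
      refine (bounded_iter hx (writesReg_zero hwf) (fun _ _ h h' => bounded_run hwf h h') hY hs k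
        (hk.trans hY)).mono ?_
      have := Nat.mul_le_mul_right (c.growth.eval Y) (hk.trans hY)
      simp only [hB', eval_add, eval_mul, eval_X]
      omega
    -- Induction on the number `j` of rounds still to be made, since an execution of a loop is
    -- assembled from its end.
    have key : ∀ j ≤ s.reg 0, ∃ T, Exec (.loop (.sub (.reg 0) (.reg x))
        (.seq c.toProg (.assign x (.add (.reg x) (.const 1)))))
        (iter x c.run s (s.reg 0 - j)) (iter x c.run s (s.reg 0)) T ∧ T ≤ (j + 1) * U := by
      intro j
      induction j with
      | zero =>
        intro _
        refine ⟨_, Exec.loop_stop ?_, ?_⟩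
        · simp [Expr.eval, iter_counter, h0]
        · have := cost_le_exprTime (hbd _ le_rfl) (by rwa [h0])
            (e := .sub (.reg 0) (.reg x)) rfl
          simp only [Nat.sub_zero]
          omega
      | succ j ihj =>
        intro hj
        obtain ⟨T, hT, hT'⟩ := ihj (by omega)
        set k := s.reg 0 - (j + 1) with hk
        have hk1 : s.reg 0 - j = k + 1 := by omega
        have hkb := hbd k (by omega)
        have hkY : (iter x c.run s k).reg 0 ≤ Y := by rwa [h0]
        obtain ⟨T1, hT1, hT1'⟩ := ih hwf hkY hkb
        have hb1 := bounded_run hwf hkY hkb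
        rw [← eval_add] at hb1
        have hY1 : (c.run (iter x c.run s k)).reg 0 ≤ Y := by rwa [run_reg_zero hwf]
        have hc1 := cost_le_exprTime hkb hkY (e := .sub (.reg 0) (.reg x)) rfl
        have hc2 := cost_le_exprTime hb1 hY1 (e := .add (.reg x) (.const 1)) rfl
        have hstep : iter x c.run s (k + 1) = (c.run (iter x c.run s k)).setReg x
            (Expr.eval (c.run (iter x c.run s k)) (.add (.reg x) (.const 1))) := by
          simp only [iter, Expr.eval, run_reg hcx, iter_counter]
        rw [hk1, hstep] at hT
        refine ⟨_, .loop_step ?_ (.seq hT1 (.assign _ _ _)) hT, ?_⟩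
        · simp only [Expr.eval, iter_counter, h0]; omega
        · rw [add_one_mul (j + 1)]; omega
    obtain ⟨T, hT, hT'⟩ := key _ le_rfl
    rw [Nat.sub_self] at hT
    refine ⟨_, .seq (.assign x (.const 0) s) hT, ?_⟩
    have hc0 := cost_le_exprTime hs hY (e := .const 0) rfl
    have : (s.reg 0 + 1) * U ≤ (Y + 1) * U := Nat.mul_le_mul_right _ (by omega)
    have ht : ((forL x c).time B).eval Y =
        1 + (1 + (exprTime (.const 0) B).eval Y) + (Y + 1) * U := by
      simp only [time, hU, hB', eval_add, eval_one, eval_mul, eval_X]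
    rw [ht]
    omega

end Cmd

theorem bounded_init (x : List ℕ) : Bounded (init x) (inputSize x) ∧ x.length ≤ inputSize x := by
  have h1 : x.length ≤ inputSize x := by
    unfold inputSize
    induction x with
    | nil => simp
    | cons a x ih => simp only [List.length_cons, List.map_cons, List.sum_cons]; omega
  have h2 : ∀ j, Nat.size (x.getD j 0) ≤ inputSize x := by
    intro j
    by_cases hj : j < x.length
    · rw [List.getD_eq_getElem _ _ hj]
      have := List.single_le_sum (l := x.map fun a => Nat.size a + 1) (by simp) (Nat.size x[j] + 1)
        (List.mem_map.2 ⟨_, List.getElem_mem hj, rfl⟩)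
      unfold inputSize; omega
    · rw [List.getD_eq_default _ _ (by omega)]; simp
  refine ⟨⟨fun r => ?_, fun a j => ?_⟩, h1⟩
  · simp only [init]; split_ifs
    · exact (size_le_self _).trans h1
    · simp
  · simp only [init]; split_ifs
    · exact h2 j
    · simp

/-- Structured programs solve search problems in polynomial time. -/
theorem solvableInPolyTime_of_cmd {α : Type} {enc : α → List ℕ} {R : α → List ℕ → Prop}
    (c : Cmd) (hc : c.wf = true) (h : ∀ a, R a (c.run (init (enc a))).out) :
    SolvableInPolyTime enc R := by
  refine ⟨c.toProg, c.time Polynomial.X, fun a => ?_⟩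
  obtain ⟨hb, hl⟩ := bounded_init (enc a)
  obtain ⟨T, hT, hT'⟩ := c.exec_toProg hc (s := init (enc a)) (B := Polynomial.X)
    (by simpa [init] using hl) (by simpa using hb)
  exact ⟨_, T, hT, hT', h a⟩

end RAM

namespace Bucklin

/-! ### The dynamic program for a fixed winning round -/

namespace DP

/-- The minimum of `cap` and `f 0, …, f (k - 1)`. -/
def capMin (f : ℕ → ℕ) (cap : ℕ) : ℕ → ℕ
  | 0 => cap
  | k + 1 => min (capMin f cap k) (f k)

theorem capMin_le {f : ℕ → ℕ} {cap k j : ℕ} (h : j < k) : capMin f cap k ≤ f j := by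
  induction k with
  | zero => omega
  | succ k ih =>
    rcases Nat.lt_succ_iff_lt_or_eq.1 h with h | rfl
    · exact (min_le_left _ _).trans (ih h)
    · exact min_le_right _ _

/-- Below the cap, the minimum is attained by a genuine index. With the penalty as cap, this turns
small table entries into actual shifts. -/
theorem exists_of_capMin_lt {f : ℕ → ℕ} {cap k : ℕ} (h : capMin f cap k < cap) :
    ∃ j < k, capMin f cap k = f j := by
  induction k with
  | zero => exact absurd h (lt_irrefl _)
  | succ k ih =>
    rcases min_choice (capMin f cap k) (f k) with h' | h'
    · rw [capMin, h'] at h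
      obtain ⟨j, hj, hj'⟩ := ih h
      exact ⟨j, by omega, by rw [capMin, h', hj']⟩
    · exact ⟨k, by omega, h'⟩

/-- `1` if shifting `p` by `t` in the vote `i` puts her on one of the positions `0, …, κ`. -/
def supports (pos : ℕ → ℕ → ℕ) (p κ i t : ℕ) : ℕ := 1 - (pos i p - t - κ)

/-- `1` if `c` is on one of the positions `0, …, κ - 1` of the vote `i`. -/
def above (pos : ℕ → ℕ → ℕ) (κ i c : ℕ) : ℕ := 1 - (pos i c + 1 - κ)

/-- `1` if `c`, being on position `κ - 1` of the vote `i`, stays there when `p` is shifted. -/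
def stays (pos : ℕ → ℕ → ℕ) (p κ i c t : ℕ) : ℕ :=
  above pos κ i c - (1 - ((κ - pos i p) + (pos i p - t + 1 - κ)))

/-- The parameters of the dynamic program: numbers of candidates and voters, designated
candidate, majority threshold, last position allowed for `p`, positions, weights of the shifts
and penalty for violated constraints. -/
structure Data where
  m : ℕ
  n : ℕ
  p : ℕ
  maj : ℕ
  κ : ℕ
  pos : ℕ → ℕ → ℕ
  w : ℕ → ℕ → ℕ
  pen : ℕ

variable (D : Data)

/-- Penalty for a candidate that reaches the majority too early. -/
def Data.penalty (c b : ℕ) : ℕ := if b = 0 ∧ c ≠ D.p then D.pen else 0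

/-- Penalty for missing supporters. -/
def Data.base (a : ℕ) : ℕ := if a = 0 then 0 else D.pen

/-- Closing the group of candidate `c`. -/
def Data.reset (c : ℕ) (H : ℕ → ℕ → ℕ) (a b : ℕ) : ℕ := H a D.maj + D.penalty c b

/-- Treating voter `i` while the score of `c` is counted: the shift is chosen if `c` is on position
`κ - 1`. -/
def Data.step (c i : ℕ) (H : ℕ → ℕ → ℕ) (a b : ℕ) : ℕ :=
  if D.pos i c = D.κ - 1 then
    capMin (fun t => D.w i t + H (a - supports D.pos D.p D.κ i t)
      (b - stays D.pos D.p D.κ i c t)) D.pen (D.m + 1)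
  else H a (b - above D.pos D.κ i c)

/-- The table after `i` voters of the group of `c`. -/
def Data.group (D : Data) (c : ℕ) (H : ℕ → ℕ → ℕ) : ℕ → ℕ → ℕ → ℕ
  | 0 => D.reset c H
  | i + 1 => D.step c i (D.group c H i)

/-- The table after `c` groups. -/
def Data.table (D : Data) : ℕ → ℕ → ℕ → ℕ
  | 0 => fun a _ => D.base a
  | c + 1 => D.group c (D.table c) D.n

/-- The value of the dynamic program. -/
def Data.value : ℕ := D.table D.m D.maj D.maj

/-- The number of supporters gained in the votes `0, …, i - 1` that belong to the group of `c`. -/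
def Data.gain (t : ℕ → ℕ) (c i : ℕ) : ℕ :=
  ∑ j ∈ Finset.range i, if D.pos j c = D.κ - 1 then supports D.pos D.p D.κ j (t j) else 0

/-- The weight of the shifts in the votes `0, …, i - 1` that belong to the group of `c`. -/
def Data.weight (t : ℕ → ℕ) (c i : ℕ) : ℕ :=
  ∑ j ∈ Finset.range i, if D.pos j c = D.κ - 1 then D.w j (t j) else 0

/-- The number of votes among `0, …, i - 1` that have `c` on the positions `0, …, κ - 1` after
the shifts. -/
def Data.count (t : ℕ → ℕ) (c i : ℕ) : ℕ :=
  ∑ j ∈ Finset.range i, if D.pos j c = D.κ - 1 then stays D.pos D.p D.κ j c (t j)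
    else above D.pos D.κ j c

variable {D}

theorem Data.gain_congr {t t' : ℕ → ℕ} {c i : ℕ}
    (h : ∀ j < i, D.pos j c = D.κ - 1 → t j = t' j) : D.gain t c i = D.gain t' c i := by
  refine Finset.sum_congr rfl fun j hj => ?_
  split_ifs with hg
  · rw [h j (Finset.mem_range.1 hj) hg]
  · rfl

theorem Data.weight_congr {t t' : ℕ → ℕ} {c i : ℕ}
    (h : ∀ j < i, D.pos j c = D.κ - 1 → t j = t' j) : D.weight t c i = D.weight t' c i := by
  refine Finset.sum_congr rfl fun j hj => ?_
  split_ifs with hg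
  · rw [h j (Finset.mem_range.1 hj) hg]
  · rfl

theorem Data.count_congr {t t' : ℕ → ℕ} {c i : ℕ}
    (h : ∀ j < i, D.pos j c = D.κ - 1 → t j = t' j) : D.count t c i = D.count t' c i := by
  refine Finset.sum_congr rfl fun j hj => ?_
  split_ifs with hg
  · rw [h j (Finset.mem_range.1 hj) hg]
  · rfl

/-- The shifts `t` are one of the choices in each minimum. The two budgets are lowered by truncated
subtraction, so successive decrements add up to `gain` and `count`. -/
theorem Data.group_le {t : ℕ → ℕ} (ht : ∀ i, t i ≤ D.m) (c : ℕ) (H : ℕ → ℕ → ℕ) (i a b : ℕ) :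
    D.group c H i a b ≤
      D.weight t c i + H (a - D.gain t c i) D.maj + D.penalty c (b - D.count t c i) := by
  induction i generalizing a b with
  | zero => simp [group, reset, weight, gain, count]
  | succ i ih =>
    simp only [group, step, weight, gain, count, Finset.sum_range_succ]
    split_ifs with hg
    · refine (capMin_le (Nat.lt_succ_of_le (ht i))).trans ?_
      refine (Nat.add_le_add_left (ih _ _) _).trans (le_of_eq ?_)
      rw [Nat.sub_sub, Nat.sub_sub, add_comm (supports _ _ _ _ _), add_comm (stays _ _ _ _ _ _)]
      simp only [weight, gain, count]
      ring
    · refine (ih _ _).trans (le_of_eq ?_)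
      rw [Nat.sub_sub, add_comm (above _ _ _ _)]
      simp only [weight, gain, count, add_zero]

theorem Data.table_le {t : ℕ → ℕ} (ht : ∀ i, t i ≤ D.m) (c a : ℕ) :
    D.table c a D.maj ≤ ∑ d ∈ Finset.range c, D.weight t d D.n +
      D.base (a - ∑ d ∈ Finset.range c, D.gain t d D.n) +
      ∑ d ∈ Finset.range c, D.penalty d (D.maj - D.count t d D.n) := by
  induction c generalizing a with
  | zero => simp [table]
  | succ c ih =>
    rw [table]
    refine (group_le ht _ _ _ _ _).trans ?_
    have := ih (a - D.gain t c D.n)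
    rw [Nat.sub_sub, add_comm (D.gain t c D.n)] at this
    simp only [Finset.sum_range_succ]
    omega

/-- Converse of `group_le`: as long as the entry is below the penalty, every minimum in the
recursion is attained, and the minimizers are collected vote by vote. Votes outside the group may
carry any value of `t`. -/
theorem Data.exists_group {c : ℕ} {H : ℕ → ℕ → ℕ} {i a b : ℕ} (h : D.group c H i a b < D.pen) :
    ∃ t : ℕ → ℕ, (∀ i, t i ≤ D.m) ∧ D.weight t c i + H (a - D.gain t c i) D.maj +
      D.penalty c (b - D.count t c i) ≤ D.group c H i a b := by
  induction i generalizing a b with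
  | zero => exact ⟨fun _ => 0, by simp, by simp [group, reset, weight, gain, count]⟩
  | succ i ih =>
    simp only [group, step] at h ⊢
    split_ifs at h ⊢ with hg
    · obtain ⟨τ, hτ, he⟩ := exists_of_capMin_lt h
      rw [he] at h ⊢
      obtain ⟨t, ht, hle⟩ := ih (lt_of_le_of_lt (Nat.le_add_left _ _) h)
      refine ⟨Function.update t i τ, fun j => ?_, ?_⟩
      · by_cases hj : j = i
        · subst hj; simp; omega
        · simpa [hj] using ht j
      · have hc : ∀ j < i, D.pos j c = D.κ - 1 → Function.update t i τ j = t j := by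
          intro j hj _
          exact Function.update_of_ne (by omega) _ _
        have h1 := weight_congr hc
        have h2 := gain_congr hc
        have h3 := count_congr hc
        simp only [weight, gain, count] at h1 h2 h3 hle
        simp only [weight, gain, count, Finset.sum_range_succ, h1, h2, h3, if_pos hg,
          Function.update_self]
        rw [Nat.sub_sub, Nat.sub_sub, add_comm (supports _ _ _ _ _),
          add_comm (stays _ _ _ _ _ _)] at hle
        omega
    · obtain ⟨t, ht, hle⟩ := ih h
      refine ⟨t, ht, ?_⟩
      simp only [weight, gain, count, Finset.sum_range_succ, if_neg hg, add_zero] at hle ⊢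
      rw [Nat.sub_sub, add_comm (above _ _ _ _)] at hle
      exact hle

/-- Each vote belongs to exactly one group. -/
structure Data.Valid (D : Data) : Prop where
  exists_group : ∀ i < D.n, ∃ c < D.m, D.pos i c = D.κ - 1
  inj : ∀ i < D.n, ∀ c < D.m, ∀ d < D.m, D.pos i c = D.pos i d → c = d

/-- Each group supplies its own shifts, and these can be glued because the groups are disjoint. -/
theorem Data.exists_table (hD : D.Valid) {c a : ℕ} (hc : c ≤ D.m)
    (h : D.table c a D.maj < D.pen) :
    ∃ t : ℕ → ℕ, (∀ i, t i ≤ D.m) ∧ ∑ d ∈ Finset.range c, D.weight t d D.n +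
      D.base (a - ∑ d ∈ Finset.range c, D.gain t d D.n) +
      ∑ d ∈ Finset.range c, D.penalty d (D.maj - D.count t d D.n) ≤ D.table c a D.maj := by
  induction c generalizing a with
  | zero => exact ⟨fun _ => 0, by simp, by simp [table]⟩
  | succ c ih =>
    rw [table] at h ⊢
    obtain ⟨t, ht, hle⟩ := Data.exists_group h
    obtain ⟨t', ht', hle'⟩ := ih (a := a - D.gain t c D.n) (by omega) (by omega)
    -- The shifts for the group of `c` come from `t`, those for all other votes from `t'`; neither
    -- choice influences the sums of the other.
    set u : ℕ → ℕ := fun i => if D.pos i c = D.κ - 1 then t i else t' i with hu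
    have hut : ∀ j < D.n, D.pos j c = D.κ - 1 → u j = t j := fun j _ hj => by simp [hu, hj]
    have hut' : ∀ d < c, ∀ j < D.n, D.pos j d = D.κ - 1 → u j = t' j := by
      intro d hd j hj hjd
      have : D.pos j c ≠ D.κ - 1 := fun hjc =>
        absurd (hD.inj j hj c (by omega) d (by omega) (hjc.trans hjd.symm)) (by omega)
      simp [hu, this]
    refine ⟨u, fun i => ?_, ?_⟩
    · simp only [hu]; split_ifs
      · exact ht i
      · exact ht' i
    · have e1 : ∑ d ∈ Finset.range c, D.weight u d D.n = ∑ d ∈ Finset.range c, D.weight t' d D.n :=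
        Finset.sum_congr rfl fun d hd => weight_congr (hut' d (Finset.mem_range.1 hd))
      have e2 : ∑ d ∈ Finset.range c, D.gain u d D.n = ∑ d ∈ Finset.range c, D.gain t' d D.n :=
        Finset.sum_congr rfl fun d hd => gain_congr (hut' d (Finset.mem_range.1 hd))
      have e3 : ∑ d ∈ Finset.range c, D.penalty d (D.maj - D.count u d D.n) =
          ∑ d ∈ Finset.range c, D.penalty d (D.maj - D.count t' d D.n) :=
        Finset.sum_congr rfl fun d hd => by rw [count_congr (hut' d (Finset.mem_range.1 hd))]
      rw [Nat.sub_sub, add_comm (D.gain t c D.n)] at hle'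
      simp only [Finset.sum_range_succ, e1, e2, e3, weight_congr hut, gain_congr hut,
        count_congr hut]
      omega

/-- Since every vote lies in exactly one group, gains and weights summed over the groups are totals
over all votes. -/
theorem Data.Valid.sum_groups (hD : D.Valid) (f : ℕ → ℕ) :
    ∑ c ∈ Finset.range D.m, ∑ j ∈ Finset.range D.n, (if D.pos j c = D.κ - 1 then f j else 0) =
      ∑ j ∈ Finset.range D.n, f j := by
  rw [Finset.sum_comm]
  refine Finset.sum_congr rfl fun j hj => ?_
  rw [Finset.mem_range] at hj
  obtain ⟨c, hc, hjc⟩ := hD.exists_group j hj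
  rw [Finset.sum_eq_single c, if_pos hjc]
  · intro d hd hdc
    refine if_neg fun h => hdc ?_
    exact hD.inj j hj d (Finset.mem_range.1 hd) c hc (h.trans hjc.symm)
  · intro h; exact absurd (Finset.mem_range.2 hc) h

/-- The shifts `t` make `p` win in the round `κ + 1` (or earlier). -/
structure Data.Good (D : Data) (t : ℕ → ℕ) : Prop where
  le : ∀ i, t i ≤ D.m
  supported : D.maj ≤ ∑ j ∈ Finset.range D.n, supports D.pos D.p D.κ j (t j)
  unbeaten : ∀ c < D.m, c ≠ D.p → D.count t c D.n < D.maj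

theorem Data.value_le (hD : D.Valid) {t : ℕ → ℕ} (ht : D.Good t) :
    D.value ≤ ∑ j ∈ Finset.range D.n, D.w j (t j) := by
  refine (table_le ht.le D.m D.maj).trans ?_
  have h1 : ∑ d ∈ Finset.range D.m, D.gain t d D.n = _ := hD.sum_groups _
  have h2 : ∑ d ∈ Finset.range D.m, D.weight t d D.n = _ := hD.sum_groups _
  have h3 : ∑ d ∈ Finset.range D.m, D.penalty d (D.maj - D.count t d D.n) = 0 := by
    refine Finset.sum_eq_zero fun d hd => if_neg fun h => ?_
    have := ht.unbeaten d (Finset.mem_range.1 hd) h.2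
    omega
  rw [h1, h2, h3, base, if_pos (Nat.sub_eq_zero_of_le ht.supported)]
  simp

/-- A violated constraint would contribute the whole penalty, so a value below it certifies that all
constraints hold. -/
theorem Data.exists_of_value_lt (hD : D.Valid) (h : D.value < D.pen) :
    ∃ t, D.Good t ∧ ∑ j ∈ Finset.range D.n, D.w j (t j) ≤ D.value := by
  obtain ⟨t, ht, hle⟩ := exists_table hD le_rfl h
  have h1 : ∑ d ∈ Finset.range D.m, D.gain t d D.n = _ := hD.sum_groups _
  have h2 : ∑ d ∈ Finset.range D.m, D.weight t d D.n = _ := hD.sum_groups _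
  rw [h1, h2] at hle
  change _ ≤ D.value at hle
  refine ⟨t, ⟨ht, ?_, fun c hc hcp => ?_⟩, by omega⟩
  · by_contra hlt
    rw [base, if_neg (by omega)] at hle
    omega
  · by_contra hlt
    have h3 : D.penalty c (D.maj - D.count t c D.n) ≤
        ∑ d ∈ Finset.range D.m, D.penalty d (D.maj - D.count t d D.n) :=
      Finset.single_le_sum (f := fun d => D.penalty d (D.maj - D.count t d D.n))
        (fun _ _ => Nat.zero_le _) (Finset.mem_range.2 hc)
    rw [penalty, if_pos ⟨by omega, hcp⟩] at h3
    omega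

end DP

end Bucklin

namespace Bucklin

theorem getD_flatten_ofFn {n K : ℕ} {f : Fin n → List ℕ} (hf : ∀ i, (f i).length = K) (i : Fin n)
    {j : ℕ} (hj : j < K) : (List.ofFn f).flatten.getD (i * K + j) 0 = (f i).getD j 0 := by
  induction n with
  | zero => exact i.elim0
  | succ n ih =>
    rw [List.ofFn_succ, List.flatten_cons]
    refine Fin.cases ?_ (fun i => ?_) i
    · rw [Fin.val_zero, zero_mul, zero_add, List.getD_append _ _ _ _ (by rw [hf]; exact hj)]
    · rw [List.getD_append_right _ _ _ _ (by rw [hf, Fin.val_succ]; nlinarith), hf,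
        ← ih (fun i => hf i.succ) i, Fin.val_succ]
      congr 1
      rw [add_one_mul]
      omega

/-! ### Winners -/

theorem score_mono {m n : ℕ} (V : Election m n) (c : Fin m) {k l : ℕ} (h : k ≤ l) :
    score V k c ≤ score V l c :=
  Finset.card_le_card fun i hi => by
    simp only [Finset.mem_filter, Finset.mem_univ, true_and] at hi ⊢
    exact hi.trans h

theorem score_zero {m n : ℕ} (V : Election m n) (c : Fin m) : score V 0 c = 0 := by
  simp [score, rank]

theorem score_full {m n : ℕ} (V : Election m n) (c : Fin m) : score V m c = n := by
  have h : ∀ i, rank (V i) c ≤ m := fun i => (V i c).isLt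
  simp [score, h]

theorem majority_le {n : ℕ} (hn : 0 < n) : majority n ≤ n := by
  unfold majority; omega

theorem majority_le_score_roundOf {m n : ℕ} (hn : 0 < n) (V : Election m n) (c : Fin m) :
    majority n ≤ score V (roundOf V c) c :=
  Nat.sInf_mem (s := {k : ℕ | majority n ≤ score V k c})
    ⟨m, by simpa [score_full] using majority_le hn⟩

theorem roundOf_le {m n : ℕ} {V : Election m n} {c : Fin m} {k : ℕ}
    (h : majority n ≤ score V k c) : roundOf V c ≤ k :=
  Nat.sInf_le h

/-- Removes the minimum over rounds: `κ + 1` need not be the winning round, only at least as large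
as the round in which `p` wins. If somebody else attains the winning round, that round comes after
`κ`, and the score of `p` is monotone in the round. -/
theorem isWinner_iff {m n : ℕ} (hn : 0 < n) (V : Election m n) (p : Fin m) :
    IsWinner V p ↔ ∃ κ < m, majority n ≤ score V (κ + 1) p ∧
      ∀ c, c ≠ p → score V κ c < majority n := by
  have hle : ∀ c, winningRound V ≤ roundOf V c := fun c => ciInf_le (OrderBot.bddBelow _) c
  have : Nonempty (Fin m) := ⟨p⟩
  constructor
  · intro h
    -- Round `0` is impossible because scores there vanish and the threshold is positive.
    obtain ⟨κ, hκ⟩ : ∃ κ, winningRound V = κ + 1 := by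
      refine Nat.exists_eq_succ_of_ne_zero fun h0 => ?_
      rw [IsWinner, h0, score_zero, majority] at h
      omega
    rw [IsWinner, hκ] at h
    refine ⟨κ, ?_, h, fun c _ => ?_⟩
    · have h1 : roundOf V p ≤ m := roundOf_le (by simpa [score_full] using majority_le hn)
      have := hle p
      omega
    · by_contra hlt
      have h1 := roundOf_le (not_lt.1 hlt)
      have := hle c
      omega
  · rintro ⟨κ, _, hp, hc⟩
    obtain ⟨c, hc'⟩ := exists_eq_ciInf_of_finite (f := fun c => roundOf V c)
    change roundOf V c = winningRound V at hc'
    rw [IsWinner, ← hc']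
    by_cases h : c = p
    · rw [h]; exact majority_le_score_roundOf hn V p
    · refine hp.trans (score_mono V p ?_)
      by_contra hlt
      have h1 := majority_le_score_roundOf hn V c
      have h2 := score_mono V c (k := roundOf V c) (l := κ) (by omega)
      have := hc c h
      omega

theorem score_eq_sum {m n : ℕ} (V : Election m n) (k : ℕ) (c : Fin m) :
    score V k c = ∑ i, if rank (V i) c ≤ k then 1 else 0 := by
  rw [score, Finset.card_filter]

theorem rank_shiftPref_self {m : ℕ} (p : Fin m) (t : ℕ) (v : Pref m) :
    rank (shiftPref p t v) p = (v p : ℕ) - t + 1 := by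
  simp [rank, shiftPref, shiftPos]

theorem rank_shiftPref_of_ne {m : ℕ} {p c : Fin m} (h : c ≠ p) (t : ℕ) (v : Pref m) :
    rank (shiftPref p t v) c =
      if (v p : ℕ) - t ≤ v c ∧ (v c : ℕ) < v p then (v c : ℕ) + 2 else (v c : ℕ) + 1 := by
  have : v c ≠ v p := fun h' => h (v.injective h')
  simp only [rank, shiftPref, shiftPos, Equiv.trans_apply, Equiv.ofBijective_apply, if_neg this]
  split_ifs <;> rfl

/-! ### Shift bribery as an instance of the dynamic program -/

namespace ShiftBribery

variable (I : ShiftBribery)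

/-- The position of the candidate `c` in the vote `i`, counted from `0`. -/
def position (i c : ℕ) : ℕ :=
  if h : i < I.n ∧ c < I.m then (I.V ⟨i, h.1⟩ ⟨c, h.2⟩ : ℕ) else 0

variable {I} in
theorem position_coe (i : Fin I.n) (c : Fin I.m) : I.position i c = (I.V i c : ℕ) := by
  simp [position]

/-- The dynamic program for the instance `I`. -/
def data (κ : ℕ) (w : ℕ → ℕ → ℕ) (pen : ℕ) : DP.Data where
  m := I.m
  n := I.n
  p := I.p
  maj := majority I.n
  κ := κ
  pos := I.position
  w := w
  pen := pen

theorem data_valid {κ : ℕ} (hκ : κ < I.m) (w : ℕ → ℕ → ℕ) (pen : ℕ) : (I.data κ w pen).Valid where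
  exists_group i hi := by
    -- For `κ = 0` truncation gives position `0`. This grouping is harmless: no candidate is in the
    -- top `0`, so `above` and `stays` vanish.
    refine ⟨(I.V ⟨i, hi⟩).symm ⟨κ - 1, by omega⟩, Fin.isLt _, ?_⟩
    change I.position ((⟨i, hi⟩ : Fin I.n) : ℕ) _ = κ - 1
    rw [position_coe]; simp
  inj i hi c hc d hd h := by
    have h' : I.position ((⟨i, hi⟩ : Fin I.n) : ℕ) ((⟨c, hc⟩ : Fin I.m) : ℕ) =
      I.position ((⟨i, hi⟩ : Fin I.n) : ℕ) ((⟨d, hd⟩ : Fin I.m) : ℕ) := h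
    rw [position_coe, position_coe, ← Fin.ext_iff] at h'
    exact Fin.mk.inj_iff.1 ((I.V _).injective h')

theorem score_shf_p (T : I.Action) {t : ℕ → ℕ} (hT : ∀ i : Fin I.n, t i = T i) (κ : ℕ) :
    score (I.shf T) (κ + 1) I.p =
      ∑ j ∈ Finset.range I.n, DP.supports I.position I.p κ j (t j) := by
  rw [score_eq_sum, Finset.sum_range]
  refine Finset.sum_congr rfl fun i _ => ?_
  rw [shf, rank_shiftPref_self, DP.supports, position_coe, hT]
  split_ifs <;> omega

/-- A candidate passed by `p` loses one place, so only the one on position `κ - 1` can leave the top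
`κ`, and she does so when `p` starts at position `κ` or later and ends before it. In all other votes
of the count the shift is irrelevant. -/
theorem score_shf_of_ne (T : I.Action) {t : ℕ → ℕ} (hT : ∀ i : Fin I.n, t i = T i) (κ : ℕ)
    (w : ℕ → ℕ → ℕ) (pen : ℕ) {c : Fin I.m} (hc : c ≠ I.p) :
    score (I.shf T) κ c = (I.data κ w pen).count t c I.n := by
  rw [score_eq_sum, DP.Data.count, Finset.sum_range]
  refine Finset.sum_congr rfl fun i _ => ?_
  have : (I.V i c : ℕ) ≠ I.V i I.p := fun h => hc ((I.V i).injective (Fin.ext h))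
  rw [shf, rank_shiftPref_of_ne hc]
  simp only [data, DP.stays, DP.above, position_coe, hT]
  split_ifs <;> omega

/-- The natural number shifts of an action. -/
def Action.toFun {I : ShiftBribery} (T : I.Action) (i : ℕ) : ℕ :=
  if h : i < I.n then (T ⟨i, h⟩ : ℕ) else 0

theorem Action.toFun_coe {I : ShiftBribery} (T : I.Action) (i : Fin I.n) :
    Action.toFun T i = T i := by
  simp [Action.toFun]

theorem succeeds_iff (T : I.Action) (w : ℕ → ℕ → ℕ) (pen : ℕ) :
    I.Succeeds T ↔ ∃ κ < I.m, (I.data κ w pen).Good (Action.toFun T) := by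
  rw [Succeeds, isWinner_iff I.n_pos]
  refine exists_congr fun κ => and_congr_right fun _ => ?_
  rw [I.score_shf_p T (Action.toFun_coe T)]
  constructor
  · rintro ⟨h1, h2⟩
    refine ⟨fun i => ?_, h1, fun c hc hcp => ?_⟩
    · unfold Action.toFun; split_ifs
      · exact Nat.le_of_lt_succ (Fin.isLt _)
      · exact Nat.zero_le _
    · have hcp' : (⟨c, hc⟩ : Fin I.m) ≠ I.p := fun h => hcp (congrArg Fin.val h)
      have := h2 ⟨c, hc⟩ hcp'
      rwa [I.score_shf_of_ne T (Action.toFun_coe T) κ w pen hcp'] at this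
  · rintro ⟨_, h1, h2⟩
    refine ⟨h1, fun c hcp => ?_⟩
    rw [I.score_shf_of_ne T (Action.toFun_coe T) κ w pen hcp]
    exact h2 c c.isLt fun h => hcp (Fin.ext h)

/-- Shifting `p` to the top everywhere wins in round one. -/
theorem exists_succeeds : ∃ T : I.Action, I.Succeeds T := by
  refine ⟨fun _ => Fin.last _, (isWinner_iff I.n_pos _ _).2 ⟨0, I.p.pos, ?_, fun c _ => ?_⟩⟩
  · have h : ∀ i, rank (I.shf (fun _ => Fin.last _) i) I.p ≤ 0 + 1 := fun i => by
      rw [shf, rank_shiftPref_self, Fin.val_last]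
      have := (I.V i I.p).isLt
      omega
    simpa [score, h] using majority_le I.n_pos
  · rw [score_zero, majority]; omega

/-- The total weight of an action. -/
def totalWeight (w : ℕ → ℕ → ℕ) (T : I.Action) : ℕ := ∑ i : Fin I.n, w i (T i)

/-- The minimum of the values of the dynamic programs. -/
def minValue (w : ℕ → ℕ → ℕ) (pen : ℕ) : ℕ :=
  DP.capMin (fun κ => (I.data κ w pen).value) pen I.m

variable {I}

theorem totalWeight_eq_sum (w : ℕ → ℕ → ℕ) (T : I.Action) :
    I.totalWeight w T = ∑ j ∈ Finset.range I.n, w j (Action.toFun T j) := by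
  rw [totalWeight, Finset.sum_range]
  simp only [Action.toFun_coe]

theorem minValue_le (w : ℕ → ℕ → ℕ) (pen : ℕ) {T : I.Action} (hT : I.Succeeds T) :
    I.minValue w pen ≤ I.totalWeight w T := by
  obtain ⟨κ, hκ, h⟩ := (I.succeeds_iff T w pen).1 hT
  refine (DP.capMin_le hκ).trans ?_
  rw [totalWeight_eq_sum]
  exact DP.Data.value_le (I.data_valid hκ w pen) h

/-- Some action succeeds and weighs less than `pen`, so the minimum is below the cap and comes from
an actual `κ`, whose table yields an action. -/
theorem exists_minValue {w : ℕ → ℕ → ℕ} {pen : ℕ} (hpen : ∀ T : I.Action, I.totalWeight w T < pen) :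
    ∃ T, I.Succeeds T ∧ I.totalWeight w T = I.minValue w pen := by
  obtain ⟨T₀, hT₀⟩ := I.exists_succeeds
  have hlt := (minValue_le w pen hT₀).trans_lt (hpen T₀)
  obtain ⟨κ, hκ, he⟩ := DP.exists_of_capMin_lt hlt
  rw [minValue] at hlt
  rw [he] at hlt
  obtain ⟨t, ht, hle⟩ := DP.Data.exists_of_value_lt (I.data_valid hκ w pen) hlt
  let T : I.Action := fun i => ⟨t i, Nat.lt_succ_of_le (ht.le i)⟩
  have hTt : ∀ i : Fin I.n, t i = T i := fun _ => rfl
  have hT : I.Succeeds T := by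
    refine (isWinner_iff I.n_pos _ _).2 ⟨κ, hκ, ?_, fun c hc => ?_⟩
    · rw [I.score_shf_p T hTt]; exact ht.supported
    · rw [I.score_shf_of_ne T hTt κ w pen hc]
      exact ht.unbeaten c c.isLt fun h => hc (Fin.ext h)
  refine ⟨T, hT, le_antisymm ?_ (minValue_le w pen hT)⟩
  rw [minValue, he, totalWeight, ← Finset.sum_range (fun j => w j (t j))]
  exact hle

/-! ### Infinite costs -/

/-- Finite replacement of a cost value, given by its code. -/
def finiteCost (M z : ℕ) : ℕ := if z ≠ 0 then z - 1 else M

/-- The code of a finite cost exceeds the cost, so every action of finite cost weighs less than `M`,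
whereas a single infinite entry already weighs `M`. If every successful action has infinite cost,
any of them is optimal. -/
theorem isOptimal_of_finiteCost {M : ℕ}
    (hM : ∑ i : Fin I.n, ∑ j : Fin (I.m + 1), costCode (I.π i j) < M)
    {w : ℕ → ℕ → ℕ} (hw : ∀ (i : Fin I.n) (j : Fin (I.m + 1)),
      w i j = finiteCost M (costCode (I.π i j)))
    {T : I.Action} (hT : I.Succeeds T)
    (hmin : ∀ S : I.Action, I.Succeeds S → I.totalWeight w T ≤ I.totalWeight w S) :
    I.IsOptimal T := by
  refine ⟨hT, fun S hS => ?_⟩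
  by_cases hfin : I.cost S = ⊤
  · rw [hfin]; exact le_top
  have hfS : ∀ i, I.π i (S i) ≠ ⊤ := fun i hi => hfin (by
    rw [cost, ← Finset.add_sum_erase _ _ (Finset.mem_univ i), hi, top_add])
  have hval : ∀ (i : Fin I.n) (j : Fin (I.m + 1)), I.π i j ≠ ⊤ → (w i j : ℕ∞) = I.π i j := by
    intro i j h
    rw [hw, costCode, if_neg h]
    simp [finiteCost, ENat.natCast_toNat h]
  have hcost : ∀ R : I.Action, (∀ i, I.π i (R i) ≠ ⊤) → (I.totalWeight w R : ℕ∞) = I.cost R := by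
    intro R hR
    rw [totalWeight, cost, Nat.cast_sum]
    exact Finset.sum_congr rfl fun i _ => hval i _ (hR i)
  have hSM : I.totalWeight w S < M := by
    refine lt_of_le_of_lt (Finset.sum_le_sum fun i _ => ?_) hM
    refine le_trans ?_ (Finset.single_le_sum (f := fun j => costCode (I.π i j))
      (fun _ _ => Nat.zero_le _) (Finset.mem_univ (S i)))
    rw [hw, costCode, if_neg (hfS i)]
    simp [finiteCost]
  -- An infinite entry of `T` would make it heavier than the successful action `S`.
  have hfT : ∀ i, I.π i (T i) ≠ ⊤ := by
    intro i hi
    have h1 : w i (T i) ≤ I.totalWeight w T :=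
      Finset.single_le_sum (f := fun i : Fin I.n => w i (T i)) (fun _ _ => Nat.zero_le _)
        (Finset.mem_univ i)
    have h2 := hmin S hS
    rw [hw, costCode, if_pos hi] at h1
    simp only [finiteCost, ne_eq, not_true_eq_false, if_false] at h1
    omega
  rw [← hcost T hfT, ← hcost S hfS]
  exact_mod_cast hmin S hS

/-! ### The layout of the description -/

variable (I)

/-- The part of the description that belongs to the voter `i`. -/
noncomputable def block (i : Fin I.n) : List ℕ :=
  (List.ofFn fun q : Fin I.m => (((I.V i).symm q : Fin I.m) : ℕ)) ++
    (List.ofFn fun j : Fin (I.m + 1) => costCode (I.π i j))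

theorem length_block (i : Fin I.n) : (I.block i).length = I.m + I.m + 1 := by
  simp [block, add_assoc]

theorem encode_eq :
    I.encode = I.m :: I.n :: (I.p : ℕ) :: (List.ofFn I.block).flatten := rfl

theorem length_encode : I.encode.length = 3 + I.n * (I.m + I.m + 1) := by
  rw [encode_eq]
  simp only [List.length_cons, List.length_flatten, List.map_ofFn, List.sum_ofFn,
    Function.comp_apply, length_block, Finset.sum_const, Finset.card_univ, Fintype.card_fin,
    smul_eq_mul]
  ring

theorem getD_encode (i : Fin I.n) {j : ℕ} (hj : j < I.m + I.m + 1) :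
    I.encode.getD (3 + i * (I.m + I.m + 1) + j) 0 = (I.block i).getD j 0 := by
  rw [encode_eq, show 3 + i * (I.m + I.m + 1) + j = i * (I.m + I.m + 1) + j + 1 + 1 + 1 by ring]
  simp only [List.getD_cons_succ]
  exact getD_flatten_ofFn I.length_block i hj

theorem getD_encode_candidate (i : Fin I.n) (q : Fin I.m) :
    I.encode.getD (3 + i * (I.m + I.m + 1) + q) 0 = ((I.V i).symm q : ℕ) := by
  rw [getD_encode I i (by omega), block, List.getD_append _ _ _ _ (by simp),
    List.getD_eq_getElem _ _ (by simp)]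
  simp

theorem getD_encode_cost (i : Fin I.n) (j : Fin (I.m + 1)) :
    I.encode.getD (3 + i * (I.m + I.m + 1) + I.m + j) 0 = costCode (I.π i j) := by
  rw [add_assoc (3 + _), getD_encode I i (by omega), block,
    List.getD_append_right _ _ _ _ (by simp),
    List.getD_eq_getElem _ _ (by rw [List.length_ofFn, List.length_ofFn]; omega)]
  simp only [List.length_ofFn, Nat.add_sub_cancel_left, List.getElem_ofFn]

/-- The cost codes are part of the input, so a machine that sums up the whole input obtains an
admissible replacement for infinity without separating costs from candidates. -/
theorem sum_costCode_le :
    ∑ i : Fin I.n, ∑ j : Fin (I.m + 1), costCode (I.π i j) ≤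
      ∑ k ∈ Finset.range I.encode.length, I.encode.getD k 0 := by
  have h : ∀ l : List ℕ, ∑ k ∈ Finset.range l.length, l.getD k 0 = l.sum := by
    intro l
    induction l with
    | nil => rfl
    | cons a l ih =>
      rw [List.length_cons, Finset.sum_range_succ', List.sum_cons, ← ih, add_comm]
      simp only [List.getD_cons_zero, List.getD_cons_succ]
  rw [h, encode_eq]
  simp only [List.sum_cons, List.sum_flatten, List.map_ofFn, List.sum_ofFn, Function.comp_apply,
    block, List.sum_append]
  rw [Finset.sum_add_distrib]
  omega

end ShiftBribery

end Bucklin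

/-! ### Guarded loops and tables on the machine -/

namespace RAM

namespace Cmd

/-- The loop over `0, …, N - 1`, where `N` is the value of register `r`. -/
def forN (x r : ℕ) (c : Cmd) : Cmd := forL x (ite (.sub (.reg r) (.reg x)) c skip)

/-- The underlying loop still makes one round per input entry, and rounds beyond `N` are idle; hence
the invariant at `min k N`. Being insensitive to the counter, it survives the increment. -/
theorem forN_induction {c : Cmd} {x r N : ℕ} {s : State} (hr : s.reg r = N) (hN : N ≤ s.reg 0)
    (hrx : r ≠ x) (hcr : c.writesReg r = false) (I : ℕ → State → Prop)
    (hI : ∀ k s v, I k s → I k (s.setReg x v)) (base : I 0 s)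
    (step : ∀ k < N, ∀ s', s'.reg x = k → Frame c x s s' → I k s' → I (k + 1) (c.run s')) :
    I N ((forN x r c).run s) := by
  have h := forL_induction (c := ite (.sub (.reg r) (.reg x)) c skip) (x := x) (s := s)
    (fun k s' => I (min k N) s') (by simpa using hI 0 s 0 base) ?_
  · rwa [min_eq_right hN] at h
  · intro k hk s' hx hf hI'
    have hr' : s'.reg r = N := by
      rw [hf.reg r hrx (by simp [writesReg, hcr]), hr]
    have he : Expr.eval s' (.sub (.reg r) (.reg x)) = N - k := by simp [Expr.eval, hr', hx]
    refine hI _ _ _ ?_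
    rw [run, he]
    split_ifs with hlt
    · rw [min_eq_left (by omega)] at hI'
      rw [min_eq_left (by omega)]
      exact step k (by omega) s' hx ⟨fun y hy h => hf.reg y hy (by simp [writesReg, h]),
        fun a h => hf.arr a (by simp [writesArr, h]),
        fun h => hf.out (by simp [writesOut, h])⟩ hI'
    · rw [min_eq_right (by omega)] at hI'
      rw [min_eq_right (by omega)]
      exact hI'

/-- The address of the entry in row `e` and column `f` of a table. -/
def cell (e f : Expr) : Expr := .add (.mul (.reg 0) e) f

/-- Zero if and only if `e` and `f` are equal. -/
def diff (e f : Expr) : Expr := .add (.sub e f) (.sub f e)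

theorem eval_cell (s : State) (e f : Expr) :
    (cell e f).eval s = s.reg 0 * e.eval s + f.eval s := rfl

theorem eval_diff_eq_zero {s : State} {e f : Expr} :
    (diff e f).eval s = 0 ↔ e.eval s = f.eval s := by
  simp only [diff, Expr.eval]; omega

/-- Fill the table `a`: the entry in row `x` and column `y` is the value of `e` after `c`. -/
def fill (x y a : ℕ) (c : Cmd) (e : Expr) : Cmd :=
  forN x 0 (forN y 0 (seq c (store a (cell (.reg x) (.reg y)) e)))

theorem cell_inj {L i j i' j' : ℕ} (hj : j < L) (hj' : j' < L) (h : L * i + j = L * i' + j') :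
    i = i' ∧ j = j' := by
  have h1 : (L * i + j) / L = (L * i' + j') / L := by rw [h]
  rw [Nat.mul_add_div (by omega), Nat.mul_add_div (by omega), Nat.div_eq_of_lt hj,
    Nat.div_eq_of_lt hj'] at h1
  simp only [add_zero] at h1
  subst h1
  omega

/-- Distinct cells have distinct addresses since columns stay below the row length, so a store never
spoils earlier entries. `hP` says nothing about the array `a`, which is partly overwritten; a new
table must therefore be built beside the old one and copied afterwards. -/
theorem fill_spec {x y a : ℕ} {c : Cmd} {e : Expr} (hx : x ≠ 0) (hy : y ≠ 0) (hxy : x ≠ y)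
    (hc0 : c.writesReg 0 = false) (hcx : c.writesReg x = false) (hcy : c.writesReg y = false)
    (hca : c.writesArr a = false) {s : State} (P : ℕ → ℕ → ℕ → Prop)
    (hP : ∀ i < s.reg 0, ∀ j < s.reg 0, ∀ s', s'.reg x = i → s'.reg y = j →
      (∀ z, z ≠ x → z ≠ y → c.writesReg z = false → s'.reg z = s.reg z) →
      (∀ b, b ≠ a → c.writesArr b = false → s'.arr b = s.arr b) →
      P i j (e.eval (c.run s'))) :
    ∀ i < s.reg 0, ∀ j < s.reg 0, P i j (((fill x y a c e).run s).arr a (s.reg 0 * i + j)) := by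
  refine forN_induction (r := 0) rfl le_rfl hx.symm (by simp [forN, writesReg, hc0, hy])
    (fun k s' => ∀ i < k, ∀ j < s.reg 0, P i j (s'.arr a (s.reg 0 * i + j)))
    (fun _ _ _ h => h) (fun i hi => absurd hi (by omega)) ?_
  intro k hk s₁ hx₁ hf₁ h₁
  have h0 : s₁.reg 0 = s.reg 0 := hf₁.reg 0 hx.symm (by simp [forN, writesReg, hc0, hy])
  have key := forN_induction (c := seq c (store a (cell (.reg x) (.reg y)) e)) (x := y) (r := 0)
    (s := s₁) h0 h0.ge hy.symm (by simp [writesReg, hc0])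
    (fun l s' => (∀ i < k, ∀ j < s.reg 0, P i j (s'.arr a (s.reg 0 * i + j))) ∧
      ∀ j < l, P k j (s'.arr a (s.reg 0 * k + j)))
    (fun _ _ _ h => h) ⟨h₁, fun i hi => absurd hi (by omega)⟩ ?_
  · intro i hi j hj
    rcases Nat.lt_succ_iff_lt_or_eq.1 hi with hi | rfl
    · exact key.1 i hi j hj
    · exact key.2 j hj
  · intro l hl s₂ hy₂ hf₂ h₂
    have hx₂ : s₂.reg x = k := by rw [hf₂.reg x hxy (by simp [writesReg, hcx]), hx₁]
    have h0₂ : s₂.reg 0 = s.reg 0 := by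
      rw [hf₂.reg 0 hy.symm (by simp [writesReg, hc0]), h0]
    have hv := hP k hk l hl s₂ hx₂ hy₂
      (fun z hzx hzy hz => by
        rw [hf₂.reg z hzy (by simp [writesReg, hz]),
          hf₁.reg z hzx (by simp [forN, writesReg, hz, hzy.symm])])
      (fun b hb hcb => by
        rw [hf₂.arr b (by simp [writesArr, hcb, hb.symm]),
          hf₁.arr b (by simp [forN, writesArr, hcb, hb.symm])])
    have haddr : (cell (.reg x) (.reg y)).eval (c.run s₂) = s.reg 0 * k + l := by
      rw [eval_cell, run_reg hc0, h0₂]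
      simp only [Expr.eval, run_reg hcx, run_reg hcy, hx₂, hy₂]
    have hrun : ((seq c (store a (cell (.reg x) (.reg y)) e)).run s₂).arr a =
        Function.update (s₂.arr a) (s.reg 0 * k + l) (e.eval (c.run s₂)) := by
      simp only [run, State.setArr, haddr, Function.update_self, run_arr hca]
    rw [hrun]
    refine ⟨fun i hi j hj => ?_, fun j hj => ?_⟩
    · rw [Function.update_of_ne]
      · exact h₂.1 i hi j hj
      · intro h; have := (cell_inj hj hl h).1; omega
    · rcases Nat.lt_succ_iff_lt_or_eq.1 hj with hj | rfl
      · rw [Function.update_of_ne (by omega)]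
        exact h₂.2 j hj
      · rw [Function.update_self]; exact hv

end Cmd

end RAM

namespace Bucklin

open RAM RAM.Cmd

namespace DP

/-! ### The dynamic program on the machine

Registers: `1` voters, `2` candidates, `3` designated candidate, `4` majority, `6` penalty,
`7` best value, `9` candidates plus one, `10`, `11` table indices, `12` shift, `13` last position
allowed, `14` candidate, `15` voter. Arrays: `1` weights, `2` table, `3` next table, `4`
positions. -/

/-- Copy the table `3` to the table `2`. -/
def copyCmd : Cmd := fill 10 11 2 skip (.load 3 (cell (.reg 10) (.reg 11)))

/-- Close a group. -/
def resetCmd : Cmd :=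
  seq (fill 10 11 3
    (seq (assign 20 (.const 0)) (ite (.reg 11) skip
      (ite (diff (.reg 14) (.reg 3)) (assign 20 (.reg 6)) skip)))
    (.add (.load 2 (cell (.reg 10) (.reg 4))) (.reg 20))) copyCmd

/-- The expression for `above`, if register `21` holds the position. -/
def aboveExpr : Expr := .sub (.const 1) (.sub (.add (.reg 21) (.const 1)) (.reg 13))

/-- The expression for `supports`, if register `22` holds the position of the designated
candidate. -/
def supportsExpr : Expr := .sub (.const 1) (.sub (.sub (.reg 22) (.reg 12)) (.reg 13))

/-- The expression for `stays`. -/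
def staysExpr : Expr := .sub aboveExpr (.sub (.const 1) (.add (.sub (.reg 13) (.reg 22))
  (.sub (.add (.sub (.reg 22) (.reg 12)) (.const 1)) (.reg 13))))

/-- Minimize over the shifts. -/
def shiftCmd : Cmd :=
  seq (assign 20 (.reg 6)) (forN 12 9
    (seq (assign 23 (.add (.load 1 (cell (.reg 15) (.reg 12)))
      (.load 2 (cell (.sub (.reg 10) supportsExpr) (.sub (.reg 11) staysExpr)))))
    (ite (.sub (.reg 20) (.reg 23)) (assign 20 (.reg 23)) skip)))

/-- Treat one voter. -/
def stepCmd : Cmd :=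
  seq (assign 21 (.load 4 (cell (.reg 15) (.reg 14))))
  (seq (assign 22 (.load 4 (cell (.reg 15) (.reg 3))))
  (seq (ite (diff (.reg 21) (.sub (.reg 13) (.const 1)))
    (fill 10 11 3 skip (.load 2 (cell (.reg 10) (.sub (.reg 11) aboveExpr))))
    (fill 10 11 3 shiftCmd (.reg 20)))
  copyCmd))

/-- Treat one group. -/
def groupCmd : Cmd := seq resetCmd (forN 15 1 stepCmd)

/-- The initial table. -/
def baseCmd : Cmd :=
  fill 10 11 2 (ite (.reg 10) (assign 20 (.reg 6)) (assign 20 (.const 0))) (.reg 20)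

/-- Compute the value for one last position. -/
def valueCmd : Cmd := seq baseCmd (forN 14 2 groupCmd)

/-- Improve the best value. -/
def improveCmd : Cmd :=
  ite (.sub (.reg 7) (.load 2 (cell (.reg 4) (.reg 4))))
    (assign 7 (.load 2 (cell (.reg 4) (.reg 4)))) skip

/-- Minimize over the last positions. -/
def minimizeCmd : Cmd := seq (assign 7 (.reg 6)) (forN 13 2 (seq valueCmd improveCmd))

/-- What the dynamic program expects in memory. -/
structure Env (D : Data) (s : State) : Prop where
  reg1 : s.reg 1 = D.n
  reg2 : s.reg 2 = D.m
  reg3 : s.reg 3 = D.p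
  reg4 : s.reg 4 = D.maj
  reg6 : s.reg 6 = D.pen
  reg9 : s.reg 9 = D.m + 1
  pos : ∀ i < D.n, ∀ c < D.m, s.arr 4 (s.reg 0 * i + c) = D.pos i c
  w : ∀ i < D.n, ∀ t ≤ D.m, s.arr 1 (s.reg 0 * i + t) = D.w i t
  n_le : D.n ≤ s.reg 0
  m_lt : D.m + 1 ≤ s.reg 0
  maj_lt : D.maj < s.reg 0
  p_lt : D.p < D.m

/-- The program changes nothing that the dynamic program expects in memory. -/
def preserves (c : Cmd) : Bool :=
  !(c.writesReg 0 || c.writesReg 1 || c.writesReg 2 || c.writesReg 3 || c.writesReg 4 ||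
    c.writesReg 6 || c.writesReg 9 || c.writesArr 1 || c.writesArr 4)

variable {D : Data} {s : State}

theorem Env.congr {s' : State} (h : Env D s) (h0 : s'.reg 0 = s.reg 0) (h1 : s'.reg 1 = s.reg 1)
    (h2 : s'.reg 2 = s.reg 2) (h3 : s'.reg 3 = s.reg 3) (h4 : s'.reg 4 = s.reg 4)
    (h6 : s'.reg 6 = s.reg 6) (h9 : s'.reg 9 = s.reg 9) (ha1 : s'.arr 1 = s.arr 1)
    (ha4 : s'.arr 4 = s.arr 4) : Env D s' := by
  obtain ⟨a1, a2, a3, a4, a6, a9, b1, b2, b3, b4, b5, b6⟩ := h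
  constructor <;> first | assumption | (simp only [h0, h1, h2, h3, h4, h6, h9, ha1, ha4]; assumption)

theorem Env.run {c : Cmd} (h : Env D s) (hc : preserves c = true) : Env D (c.run s) := by
  simp only [preserves, Bool.not_eq_true', Bool.or_eq_false_iff] at hc
  obtain ⟨⟨⟨⟨⟨⟨⟨⟨c0, c1⟩, c2⟩, c3⟩, c4⟩, c6⟩, c9⟩, d1⟩, d4⟩ := hc
  exact h.congr (run_reg c0 s) (run_reg c1 s) (run_reg c2 s) (run_reg c3 s) (run_reg c4 s)
    (run_reg c6 s) (run_reg c9 s) (run_arr d1 s) (run_arr d4 s)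

theorem Env.frame {c : Cmd} {x : ℕ} {s' : State} (h : Env D s) (hf : Frame c x s s')
    (hx : 9 < x) (hc : preserves c = true) : Env D s' := by
  simp only [preserves, Bool.not_eq_true', Bool.or_eq_false_iff] at hc
  obtain ⟨⟨⟨⟨⟨⟨⟨⟨c0, c1⟩, c2⟩, c3⟩, c4⟩, c6⟩, c9⟩, d1⟩, d4⟩ := hc
  exact h.congr (hf.reg _ (by omega) c0) (hf.reg _ (by omega) c1) (hf.reg _ (by omega) c2)
    (hf.reg _ (by omega) c3) (hf.reg _ (by omega) c4) (hf.reg _ (by omega) c6)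
    (hf.reg _ (by omega) c9) (hf.arr _ d1) (hf.arr _ d4)

/-- The table `a` in memory is `H`. -/
def Holds (s : State) (a : ℕ) (H : ℕ → ℕ → ℕ) : Prop :=
  ∀ i < s.reg 0, ∀ j < s.reg 0, s.arr a (s.reg 0 * i + j) = H i j

theorem copyCmd_spec {H : ℕ → ℕ → ℕ} (h : Holds s 3 H) : Holds (copyCmd.run s) 2 H := by
  have h0 : (copyCmd.run s).reg 0 = s.reg 0 := run_reg rfl s
  intro i hi j hj
  rw [h0] at hi hj ⊢
  refine fill_spec (by decide) (by decide) (by decide) rfl rfl rfl rfl (fun i j v => v = H i j)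
    ?_ i hi j hj
  intro i hi j hj s' hx hy hr ha
  have h0' : s'.reg 0 = s.reg 0 := hr 0 (by decide) (by decide) rfl
  have h3 : s'.arr 3 = s.arr 3 := ha 3 (by decide) rfl
  simp only [Cmd.run, Expr.eval, cell, hx, hy, h0', h3]
  exact h i hi j hj

theorem resetCmd_spec {H : ℕ → ℕ → ℕ} {c : ℕ} (hs : Env D s) (hc : s.reg 14 = c)
    (h : Holds s 2 H) : Holds (resetCmd.run s) 2 (D.reset c H) := by
  refine copyCmd_spec fun i hi j hj => ?_
  rw [run_reg rfl] at hi hj ⊢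
  refine fill_spec (by decide) (by decide) (by decide) rfl rfl rfl rfl
    (fun i j v => v = D.reset c H i j) ?_ i hi j hj
  intro i hi j hj s' hx hy hr ha
  have h0 : s'.reg 0 = s.reg 0 := hr 0 (by decide) (by decide) rfl
  have h3 : s'.reg 3 = s.reg 3 := hr 3 (by decide) (by decide) rfl
  have h4 : s'.reg 4 = s.reg 4 := hr 4 (by decide) (by decide) rfl
  have h6 : s'.reg 6 = s.reg 6 := hr 6 (by decide) (by decide) rfl
  have h14 : s'.reg 14 = s.reg 14 := hr 14 (by decide) (by decide) rfl
  have ha2 : s'.arr 2 = s.arr 2 := ha 2 (by decide) rfl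
  have hH := h i hi D.maj hs.maj_lt
  simp only [Cmd.run, ne_eq, eval_diff_eq_zero]
  by_cases hj0 : j = 0
  · by_cases hcp : c = D.p
    · simp [Expr.eval, cell, State.setReg, hx, hy, h0, h3, h4, h14, ha2, hc, hs.reg3, hs.reg4,
        Data.reset, Data.penalty, hj0, hcp, hH]
    · simp [Expr.eval, cell, State.setReg, hx, hy, h0, h3, h4, h6, h14, ha2, hc, hs.reg3, hs.reg4,
        hs.reg6, Data.reset, Data.penalty, hj0, hcp, hH]
  · simp [Expr.eval, cell, State.setReg, hx, hy, h0, h4, ha2, hs.reg4, Data.reset, Data.penalty,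
      hj0, hH]

/-- Register `20` holds the running minimum, starting from the penalty as cap. The truncated
difference of the machine is that of `ℕ`, and budgets only decrease, so all table addresses stay in
range. -/
theorem shiftCmd_spec {H : ℕ → ℕ → ℕ} {a b c i : ℕ} (hs : Env D s) (h13 : s.reg 13 = D.κ)
    (h15 : s.reg 15 = i) (hi : i < D.n) (h21 : s.reg 21 = D.pos i c)
    (h22 : s.reg 22 = D.pos i D.p) (ha : s.reg 10 = a) (hb : s.reg 11 = b) (haL : a < s.reg 0)
    (hbL : b < s.reg 0) (h : Holds s 2 H) :
    (shiftCmd.run s).reg 20 = capMin (fun t => D.w i t + H (a - supports D.pos D.p D.κ i t)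
      (b - stays D.pos D.p D.κ i c t)) D.pen (D.m + 1) := by
  rw [shiftCmd, Cmd.run]
  refine forN_induction (s := (assign 20 (.reg 6)).run s) (r := 9) hs.reg9 hs.m_lt (by decide) rfl
    (fun k s' => s'.reg 20 = capMin (fun t => D.w i t + H (a - supports D.pos D.p D.κ i t)
      (b - stays D.pos D.p D.κ i c t)) D.pen k)
    (fun k s' v hk => by simpa [State.setReg] using hk)
    (by simpa [Cmd.run, Expr.eval, State.setReg, capMin] using hs.reg6) ?_
  intro t ht s' hx hf hI
  have hr : ∀ z, z ≠ 12 → z ≠ 20 → z ≠ 23 → s'.reg z = s.reg z := fun z h1 h2 h3 => by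
    rw [hf.reg z h1 (by simp [writesReg, h2.symm, h3.symm])]
    simp [Cmd.run, State.setReg, h2]
  have ha1 : s'.arr 1 = s.arr 1 := hf.arr 1 rfl
  have ha2 : s'.arr 2 = s.arr 2 := hf.arr 2 rfl
  have h0 := hr 0 (by decide) (by decide) (by decide)
  have hw := hs.w i hi t (by omega)
  have hH := h (a - supports D.pos D.p D.κ i t) (by omega) (b - stays D.pos D.p D.κ i c t)
    (by omega)
  have he : Expr.eval s' (.add (.load 1 (cell (.reg 15) (.reg 12)))
      (.load 2 (cell (.sub (.reg 10) supportsExpr) (.sub (.reg 11) staysExpr)))) =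
      D.w i t + H (a - supports D.pos D.p D.κ i t) (b - stays D.pos D.p D.κ i c t) := by
    rw [← hH, ← hw]
    simp only [Expr.eval, cell, supportsExpr, staysExpr, aboveExpr, supports, stays, above, hx,
      ha1, ha2, h0, hr 10 (by decide) (by decide) (by decide),
      hr 11 (by decide) (by decide) (by decide), hr 13 (by decide) (by decide) (by decide),
      hr 15 (by decide) (by decide) (by decide), hr 21 (by decide) (by decide) (by decide),
      hr 22 (by decide) (by decide) (by decide), h13, h15, h21, h22, ha, hb]
  rw [Cmd.run, Cmd.run, Cmd.run, he, capMin]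
  generalize D.w i t + H (a - supports D.pos D.p D.κ i t) (b - stays D.pos D.p D.κ i c t) = v
  have hI' : (s'.setReg 23 v).reg 20 = s'.reg 20 := by simp [State.setReg]
  have hv : (s'.setReg 23 v).reg 23 = v := by simp [State.setReg]
  simp only [Expr.eval, hI', hv]
  split_ifs with hlt
  · simp only [Cmd.run, Expr.eval, hv]
    simp only [State.setReg, Function.update_self]
    omega
  · rw [Cmd.run, hI']
    omega

theorem stepCmd_spec {H : ℕ → ℕ → ℕ} {c i : ℕ} (hs : Env D s) (h13 : s.reg 13 = D.κ)
    (h14 : s.reg 14 = c) (h15 : s.reg 15 = i) (hc : c < D.m) (hi : i < D.n) (h : Holds s 2 H) :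
    Holds (stepCmd.run s) 2 (D.step c i H) := by
  set s₁ := (assign 21 (.load 4 (cell (.reg 15) (.reg 14)))).run s with hs₁
  set s₂ := (assign 22 (.load 4 (cell (.reg 15) (.reg 3)))).run s₁ with hs₂
  have hr : ∀ z, z ≠ 21 → z ≠ 22 → s₂.reg z = s.reg z := fun z h1 h2 => by
    simp [hs₁, hs₂, Cmd.run, State.setReg, h1, h2]
  have harr : s₂.arr = s.arr := rfl
  have hE : Env D s₂ := (hs.run rfl).run rfl
  have h0 := hr 0 (by decide) (by decide)
  have h21 : s₂.reg 21 = D.pos i c := by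
    rw [← hs.pos i hi c hc]
    simp [hs₁, hs₂, Cmd.run, State.setReg, Expr.eval, cell, h14, h15]
  have h22 : s₂.reg 22 = D.pos i D.p := by
    rw [← hs.pos i hi D.p hs.p_lt]
    simp [hs₁, hs₂, Cmd.run, State.setReg, Expr.eval, cell, h15, hs.reg3]
  have h13' : s₂.reg 13 = D.κ := (hr 13 (by decide) (by decide)).trans h13
  have h15' : s₂.reg 15 = i := (hr 15 (by decide) (by decide)).trans h15
  have hH : Holds s₂ 2 H := by rw [Holds, h0, harr]; exact h
  -- `diff` is nonzero outside the group of `c`, so the first branch is the one where no shift is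
  -- chosen.
  have hrun : stepCmd.run s = copyCmd.run ((ite (diff (.reg 21) (.sub (.reg 13) (.const 1)))
    (fill 10 11 3 skip (.load 2 (cell (.reg 10) (.sub (.reg 11) aboveExpr))))
    (fill 10 11 3 shiftCmd (.reg 20))).run s₂) := rfl
  rw [hrun]
  refine copyCmd_spec fun a ha b hb => ?_
  rw [run_reg rfl] at ha hb ⊢
  have hz : (diff (.reg 21) (.sub (.reg 13) (.const 1))).eval s₂ = 0 ↔ D.pos i c = D.κ - 1 := by
    simp only [eval_diff_eq_zero, Expr.eval, h21, h13']
  rw [Cmd.run, Data.step]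
  by_cases hg : D.pos i c = D.κ - 1
  · rw [if_neg (not_not.2 (hz.2 hg)), if_pos hg]
    refine fill_spec (by decide) (by decide) (by decide) rfl rfl rfl rfl
      (fun a b v => v = capMin (fun t => D.w i t + H (a - supports D.pos D.p D.κ i t)
        (b - stays D.pos D.p D.κ i c t)) D.pen (D.m + 1)) ?_ a ha b hb
    intro a ha b hb s' hx hy hr' ha'
    have e0 : s'.reg 0 = s₂.reg 0 := hr' 0 (by decide) (by decide) rfl
    refine shiftCmd_spec (hE.congr e0 (hr' 1 (by decide) (by decide) rfl)
      (hr' 2 (by decide) (by decide) rfl) (hr' 3 (by decide) (by decide) rfl)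
      (hr' 4 (by decide) (by decide) rfl) (hr' 6 (by decide) (by decide) rfl)
      (hr' 9 (by decide) (by decide) rfl) (ha' 1 (by decide) rfl) (ha' 4 (by decide) rfl))
      ((hr' 13 (by decide) (by decide) rfl).trans h13')
      ((hr' 15 (by decide) (by decide) rfl).trans h15') hi
      ((hr' 21 (by decide) (by decide) rfl).trans h21)
      ((hr' 22 (by decide) (by decide) rfl).trans h22) hx hy (by omega) (by omega) ?_
    rw [Holds, e0, ha' 2 (by decide) rfl]
    exact hH
  · rw [if_pos (mt hz.1 hg), if_neg hg]
    refine fill_spec (by decide) (by decide) (by decide) rfl rfl rfl rfl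
      (fun a b v => v = H a (b - above D.pos D.κ i c)) ?_ a ha b hb
    intro a ha b hb s' hx hy hr' ha'
    have e0 : s'.reg 0 = s₂.reg 0 := hr' 0 (by decide) (by decide) rfl
    have e13 := (hr' 13 (by decide) (by decide) rfl).trans h13'
    have e21 := (hr' 21 (by decide) (by decide) rfl).trans h21
    rw [← hH a ha (b - above D.pos D.κ i c) (by omega), above]
    simp only [Cmd.run, Expr.eval, cell, aboveExpr, hx, hy, e0, e13, e21, ha' 2 (by decide) rfl]

theorem groupCmd_spec {H : ℕ → ℕ → ℕ} {c : ℕ} (hs : Env D s) (h13 : s.reg 13 = D.κ)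
    (h14 : s.reg 14 = c) (hc : c < D.m) (h : Holds s 2 H) :
    Holds (groupCmd.run s) 2 (D.group c H D.n) := by
  have hE : Env D (resetCmd.run s) := hs.run rfl
  rw [groupCmd, Cmd.run]
  refine forN_induction (s := resetCmd.run s) hE.reg1 hE.n_le (by decide) rfl
    (fun k s' => Holds s' 2 (D.group c H k))
    (fun k s' v hk => by simpa [Holds, State.setReg] using hk) (resetCmd_spec hs h14 h) ?_
  intro i hi s' hx hf hI
  refine stepCmd_spec (hE.frame hf (by decide) rfl) ?_ ?_ hx hc hi hI
  · rw [hf.reg 13 (by decide) rfl, run_reg rfl, h13]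
  · rw [hf.reg 14 (by decide) rfl, run_reg rfl, h14]

theorem baseCmd_spec (hs : Env D s) : Holds (baseCmd.run s) 2 (fun a _ => D.base a) := by
  intro a ha b hb
  rw [run_reg rfl] at ha hb ⊢
  refine fill_spec (by decide) (by decide) (by decide) rfl rfl rfl rfl
    (fun a _ v => v = D.base a) ?_ a ha b hb
  intro a ha b hb s' hx hy hr ha'
  have h6 := (hr 6 (by decide) (by decide) rfl).trans hs.reg6
  by_cases h0 : a = 0 <;>
  simp [Cmd.run, Expr.eval, State.setReg, hx, h6, Data.base, h0]

theorem valueCmd_spec (hs : Env D s) (h13 : s.reg 13 = D.κ) :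
    Holds (valueCmd.run s) 2 (D.table D.m) := by
  have hE : Env D (baseCmd.run s) := hs.run rfl
  rw [valueCmd, Cmd.run]
  refine forN_induction (s := baseCmd.run s) hE.reg2 (by have := hE.m_lt; omega) (by decide) rfl
    (fun k s' => Holds s' 2 (D.table k))
    (fun k s' v hk => by simpa [Holds, State.setReg] using hk) (baseCmd_spec hs) ?_
  intro c hc s' hx hf hI
  refine groupCmd_spec (hE.frame hf (by decide) rfl) ?_ hx hc hI
  rw [hf.reg 13 (by decide) rfl, run_reg rfl, h13]

/-- The memory layout does not involve `κ`, so one setup serves all rounds. -/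
theorem Env.withLast (hs : Env D s) (κ : ℕ) : Env { D with κ := κ } s := by
  obtain ⟨a1, a2, a3, a4, a6, a9, b1, b2, b3, b4, b5, b6⟩ := hs
  constructor <;> assumption

theorem minimizeCmd_spec (hs : Env D s) :
    (minimizeCmd.run s).reg 7 =
      capMin (fun κ => Data.value { D with κ := κ }) D.pen D.m := by
  have hE : Env D ((assign 7 (.reg 6)).run s) := hs.run rfl
  rw [minimizeCmd, Cmd.run]
  refine forN_induction (s := (assign 7 (.reg 6)).run s) hE.reg2
    (by have := hE.m_lt; omega) (by decide) rfl
    (fun k s' => s'.reg 7 = capMin (fun κ => Data.value { D with κ := κ }) D.pen k)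
    (fun k s' v hk => by simpa [State.setReg] using hk)
    (by simpa [Cmd.run, State.setReg, Expr.eval, capMin] using hs.reg6) ?_
  intro κ hκ s' hx hf hI
  have hE' : Env { D with κ := κ } s' := (hE.frame hf (by decide) rfl).withLast κ
  have hV := valueCmd_spec hE' hx
  have hE2 : Env { D with κ := κ } (valueCmd.run s') := hE'.run rfl
  have hv := hV D.maj hE2.maj_lt D.maj hE2.maj_lt
  change _ = Data.value { D with κ := κ } at hv
  have h4 : (valueCmd.run s').reg 4 = D.maj := hE2.reg4
  have h7 : (valueCmd.run s').reg 7 = s'.reg 7 := run_reg rfl s'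
  rw [Cmd.run, improveCmd, Cmd.run, capMin, ← hI]
  simp only [Expr.eval, cell, h4, hv, h7]
  split_ifs with hlt
  · simp only [Cmd.run, Expr.eval, h4, hv, State.setReg, Function.update_self]
    omega
  · rw [Cmd.run, h7]
    omega

/-- Compute the penalty, one more than the sum of all weights in memory. -/
def penaltyCmd : Cmd :=
  seq (assign 6 (.const 1))
    (forN 10 0 (forN 11 0 (assign 6 (.add (.reg 6) (.load 1 (cell (.reg 10) (.reg 11)))))))

theorem penaltyCmd_spec : (penaltyCmd.run s).reg 6 =
    1 + ∑ i ∈ Finset.range (s.reg 0), ∑ t ∈ Finset.range (s.reg 0),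
      s.arr 1 (s.reg 0 * i + t) := by
  rw [penaltyCmd, Cmd.run]
  refine forN_induction (s := (assign 6 (.const 1)).run s) rfl le_rfl (by decide) rfl
    (fun k s' => s'.reg 6 = 1 + ∑ i ∈ Finset.range k, ∑ t ∈ Finset.range (s.reg 0),
      s.arr 1 (s.reg 0 * i + t))
    (fun k s' v hk => by simpa [State.setReg] using hk)
    (by simp [Cmd.run, State.setReg, Expr.eval]) ?_
  intro i hi s₁ hx hf hI
  have h0 : s₁.reg 0 = s.reg 0 := hf.reg 0 (by decide) rfl
  rw [Finset.sum_range_succ, ← add_assoc]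
  refine forN_induction (s := s₁) h0 h0.ge (by decide) rfl
    (fun k s' => s'.reg 6 = 1 + ∑ i ∈ Finset.range i, ∑ t ∈ Finset.range (s.reg 0),
      s.arr 1 (s.reg 0 * i + t) + ∑ t ∈ Finset.range k, s.arr 1 (s.reg 0 * i + t))
    (fun k s' v hk => by simpa [State.setReg] using hk) (by simpa using hI) ?_
  intro t ht s₂ hx₂ hf₂ hI₂
  have h0₂ : s₂.reg 0 = s.reg 0 := (hf₂.reg 0 (by decide) rfl).trans h0
  have h10 : s₂.reg 10 = i := (hf₂.reg 10 (by decide) rfl).trans hx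
  have ha : s₂.arr 1 = s.arr 1 := (hf₂.arr 1 rfl).trans (hf.arr 1 rfl)
  simp only [Cmd.run, Expr.eval, cell, State.setReg, Function.update_self, h0₂, h10, hx₂, ha, hI₂]
  rw [Finset.sum_range_succ, add_assoc]

end DP

end Bucklin

namespace Bucklin

open RAM RAM.Cmd

namespace ShiftBribery

/-! ### Reading the instance -/

/-- Read the numbers of candidates and voters and the designated candidate. -/
def headerCmd : Cmd :=
  seq (assign 2 (.load 0 (.const 0))) (seq (assign 1 (.load 0 (.const 1)))
    (seq (assign 3 (.load 0 (.const 2))) (assign 9 (.add (.reg 2) (.const 1)))))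

/-- Compute the majority threshold in register `4`. -/
def majorityCmd : Cmd :=
  seq (assign 4 (.const 0)) (forN 10 0
    (ite (.sub (.add (.reg 1) (.const 1)) (.add (.reg 10) (.reg 10)))
      (assign 4 (.add (.reg 10) (.const 1))) skip))

/-- Compute in array `7` where the voters start in the input. -/
def offsetCmd : Cmd :=
  seq (assign 20 (.const 3)) (forN 10 0 (seq (store 7 (.reg 10) (.reg 20))
    (assign 20 (.add (.reg 20) (.add (.add (.reg 2) (.reg 2)) (.const 1))))))

/-- Compute the replacement for infinite costs in register `5`. -/
def infinityCmd : Cmd :=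
  seq (assign 5 (.const 1)) (forN 10 0 (assign 5 (.add (.reg 5) (.load 0 (.reg 10)))))

/-- Compute the powers of the input length in array `5`. -/
def powerCmd : Cmd :=
  seq (assign 20 (.const 1)) (forN 10 0 (seq (store 5 (.reg 10) (.reg 20))
    (assign 20 (.mul (.reg 0) (.reg 20)))))

/-- Search a candidate in a vote. -/
def searchCmd : Cmd :=
  seq (assign 20 (.const 0)) (forN 12 2
    (ite (diff (.load 0 (.add (.load 7 (.reg 10)) (.reg 12))) (.reg 11)) skip
      (assign 20 (.reg 12))))

/-- Compute the table of positions. -/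
def positionCmd : Cmd := fill 10 11 4 searchCmd (.reg 20)

variable {s : State}

/-- There is no division: the test at `k` succeeds if and only if `2 * k ≤ n`, and the last
successful `k` is `n / 2`. -/
theorem majorityCmd_spec (h : s.reg 1 < s.reg 0) :
    (majorityCmd.run s).reg 4 = majority (s.reg 1) := by
  rw [majorityCmd, Cmd.run]
  have key := forN_induction (s := (assign 4 (.const 0)).run s) (N := s.reg 0) (r := 0) (x := 10)
    (c := ite (.sub (.add (.reg 1) (.const 1)) (.add (.reg 10) (.reg 10)))
      (assign 4 (.add (.reg 10) (.const 1))) skip) rfl le_rfl (by decide) rfl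
    (fun k s' => s'.reg 4 = min k (majority (s.reg 1)))
    (fun k s' v hk => by simpa [State.setReg] using hk)
    (by simp [Cmd.run, State.setReg, Expr.eval]) ?_
  · rw [key]; unfold majority; omega
  · intro k hk s' hx hf hI
    have h1 : s'.reg 1 = s.reg 1 := hf.reg 1 (by decide) rfl
    rw [Cmd.run]
    simp only [Expr.eval, h1, hx]
    unfold majority at *
    split_ifs with hlt
    · simp only [Cmd.run, Expr.eval, hx, State.setReg, Function.update_self]; omega
    · simp only [Cmd.run, hI]; omega

theorem offsetCmd_spec : ∀ i < s.reg 0,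
    (offsetCmd.run s).arr 7 i = 3 + i * (s.reg 2 + s.reg 2 + 1) := by
  rw [offsetCmd, Cmd.run]
  refine (forN_induction (s := (assign 20 (.const 3)).run s) (N := s.reg 0) (r := 0) (x := 10)
    rfl le_rfl (by decide) rfl
    (fun k s' => (∀ i < k, s'.arr 7 i = 3 + i * (s.reg 2 + s.reg 2 + 1)) ∧
      s'.reg 20 = 3 + k * (s.reg 2 + s.reg 2 + 1))
    (fun k s' v hk => by simpa [State.setReg] using hk)
    (by simp [Cmd.run, State.setReg, Expr.eval]) ?_).1
  intro k hk s' hx hf hI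
  have h2 : s'.reg 2 = s.reg 2 := hf.reg 2 (by decide) rfl
  refine ⟨fun i hi => ?_, ?_⟩
  · simp only [Cmd.run, Expr.eval, State.setReg, State.setArr, Function.update_self, hx]
    rcases Nat.lt_succ_iff_lt_or_eq.1 hi with hi | rfl
    · rw [Function.update_of_ne (by omega)]; exact hI.1 i hi
    · rw [Function.update_self]; exact hI.2
  · simp only [Cmd.run, Expr.eval, State.setReg, State.setArr, Function.update_self, h2, hI.2]
    ring

theorem infinityCmd_spec :
    (infinityCmd.run s).reg 5 = 1 + ∑ j ∈ Finset.range (s.reg 0), s.arr 0 j := by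
  rw [infinityCmd, Cmd.run]
  refine forN_induction (s := (assign 5 (.const 1)).run s) (N := s.reg 0) (r := 0) (x := 10)
    rfl le_rfl (by decide) rfl
    (fun k s' => s'.reg 5 = 1 + ∑ j ∈ Finset.range k, s.arr 0 j)
    (fun k s' v hk => by simpa [State.setReg] using hk)
    (by simp [Cmd.run, State.setReg, Expr.eval]) ?_
  intro k hk s' hx hf hI
  have ha : s'.arr 0 = s.arr 0 := hf.arr 0 rfl
  simp only [Cmd.run, Expr.eval, State.setReg, Function.update_self, hx, ha, hI]
  rw [Finset.sum_range_succ, add_assoc]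

theorem powerCmd_spec : ∀ i < s.reg 0, (powerCmd.run s).arr 5 i = s.reg 0 ^ i := by
  rw [powerCmd, Cmd.run]
  refine (forN_induction (s := (assign 20 (.const 1)).run s) (N := s.reg 0) (r := 0) (x := 10)
    rfl le_rfl (by decide) rfl
    (fun k s' => (∀ i < k, s'.arr 5 i = s.reg 0 ^ i) ∧ s'.reg 20 = s.reg 0 ^ k)
    (fun k s' v hk => by simpa [State.setReg] using hk)
    (by simp [Cmd.run, State.setReg, Expr.eval]) ?_).1
  intro k hk s' hx hf hI
  have h0 : s'.reg 0 = s.reg 0 := hf.reg 0 (by decide) rfl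
  refine ⟨fun i hi => ?_, ?_⟩
  · simp only [Cmd.run, Expr.eval, State.setReg, State.setArr, Function.update_self, hx]
    rcases Nat.lt_succ_iff_lt_or_eq.1 hi with hi | rfl
    · rw [Function.update_of_ne (by omega)]; exact hI.1 i hi
    · rw [Function.update_self]; exact hI.2
  · simp only [Cmd.run, Expr.eval, State.setReg, State.setArr, Function.update_self, h0, hI.2]
    ring

/-- The input lists candidates by position, while the dynamic program needs positions by candidate.
By uniqueness no later round overwrites the position found. -/
theorem searchCmd_spec {i c q : ℕ} (hi : s.reg 10 = i) (hc : s.reg 11 = c)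
    (hm : s.reg 2 ≤ s.reg 0) (hq : q < s.reg 2) (hqc : s.arr 0 (s.arr 7 i + q) = c)
    (huniq : ∀ r < s.reg 2, s.arr 0 (s.arr 7 i + r) = c → r = q) :
    (searchCmd.run s).reg 20 = q := by
  rw [searchCmd, Cmd.run]
  have key := forN_induction (s := (assign 20 (.const 0)).run s) (N := s.reg 2) (r := 2) (x := 12)
    (c := (ite (diff (.load 0 (.add (.load 7 (.reg 10)) (.reg 12))) (.reg 11)) skip
      (assign 20 (.reg 12))))
    rfl hm (by decide) rfl
    (fun k s' => q < k → s'.reg 20 = q)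
    (fun k s' v hk => by simpa [State.setReg] using hk) (by simp) ?_
  · exact key hq
  · intro k hk s' hx hf hI hlt
    have h10 : s'.reg 10 = i := (hf.reg 10 (by decide) rfl).trans hi
    have h11 : s'.reg 11 = c := (hf.reg 11 (by decide) rfl).trans hc
    have ha0 : s'.arr 0 = s.arr 0 := hf.arr 0 rfl
    have ha7 : s'.arr 7 = s.arr 7 := hf.arr 7 rfl
    rw [Cmd.run]
    have hz : (diff (.load 0 (.add (.load 7 (.reg 10)) (.reg 12))) (.reg 11)).eval s' = 0 ↔
        s.arr 0 (s.arr 7 i + k) = c := by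
      simp only [eval_diff_eq_zero, Expr.eval, h10, h11, ha0, ha7, hx]
    split_ifs with h
    · rcases Nat.lt_succ_iff_lt_or_eq.1 hlt with hlt | rfl
      · exact hI hlt
      · exact absurd (hz.2 hqc) h
    · have := huniq k hk (hz.1 (not_not.1 h))
      simpa [Cmd.run, Expr.eval, State.setReg, hx] using this

variable (I : ShiftBribery)

/-- The replacement for infinite costs. -/
noncomputable def bigCost : ℕ :=
  1 + ∑ k ∈ Finset.range I.encode.length, I.encode.getD k 0

/-- What the preparation of the instance leaves in memory. -/
structure Setup (s : State) : Prop where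
  len : s.reg 0 = I.encode.length
  reg1 : s.reg 1 = I.n
  reg2 : s.reg 2 = I.m
  reg3 : s.reg 3 = I.p
  reg4 : s.reg 4 = majority I.n
  reg5 : s.reg 5 = I.bigCost
  reg9 : s.reg 9 = I.m + 1
  input : ∀ j, s.arr 0 j = I.encode.getD j 0
  pos : ∀ i < I.n, ∀ c < I.m, s.arr 4 (s.reg 0 * i + c) = I.position i c
  power : ∀ i < s.reg 0, s.arr 5 i = s.reg 0 ^ i
  offset : ∀ i < s.reg 0, s.arr 7 i = 3 + i * (I.m + I.m + 1)

/-- Prepare the instance. -/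
def setupCmd : Cmd :=
  seq headerCmd (seq majorityCmd (seq offsetCmd (seq infinityCmd (seq powerCmd positionCmd))))

theorem n_lt_length : I.n < I.encode.length := by
  rw [length_encode]; nlinarith

theorem m_lt_length : I.m + 1 < I.encode.length := by
  rw [length_encode]; nlinarith [I.n_pos]

theorem setupCmd_spec : I.Setup (setupCmd.run (init I.encode)) := by
  have hn := I.n_lt_length
  have hm := I.m_lt_length
  set s₀ := init I.encode with hs₀
  set s₁ := headerCmd.run s₀ with hs₁
  set s₂ := majorityCmd.run s₁ with hs₂
  set s₃ := offsetCmd.run s₂ with hs₃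
  set s₄ := infinityCmd.run s₃ with hs₄
  set s₅ := powerCmd.run s₄ with hs₅
  have hrun : setupCmd.run s₀ = positionCmd.run s₅ := rfl
  have len₁ : s₁.reg 0 = I.encode.length := run_reg rfl s₀
  have input₁ : ∀ j, s₁.arr 0 j = I.encode.getD j 0 := fun j => rfl
  have m₁ : s₁.reg 2 = I.m := rfl
  have n₁ : s₁.reg 1 = I.n := rfl
  have p₁ : s₁.reg 3 = I.p := rfl
  have r₁ : s₁.reg 9 = I.m + 1 := rfl
  have maj₂ : s₂.reg 4 = majority I.n := by rw [← n₁]; exact majorityCmd_spec (by omega)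
  have len₂ : s₂.reg 0 = I.encode.length := (run_reg rfl s₁).trans len₁
  have m₂ : s₂.reg 2 = I.m := (run_reg rfl s₁).trans m₁
  have off₃ : ∀ i < s₂.reg 0, s₃.arr 7 i = 3 + i * (I.m + I.m + 1) := by
    rw [← m₂]; exact offsetCmd_spec
  have len₃ : s₃.reg 0 = I.encode.length := (run_reg rfl s₂).trans len₂
  have input₃ : s₃.arr 0 = s₁.arr 0 := (run_arr rfl s₂).trans (run_arr rfl s₁)
  have inf₄ : s₄.reg 5 = I.bigCost := by
    rw [hs₄, infinityCmd_spec, len₃, input₃]; rfl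
  have len₄ : s₄.reg 0 = I.encode.length := (run_reg rfl s₃).trans len₃
  have pow₅ : ∀ i < s₄.reg 0, s₅.arr 5 i = s₄.reg 0 ^ i := powerCmd_spec
  have len₅ : s₅.reg 0 = I.encode.length := (run_reg rfl s₄).trans len₄
  have m₅ : s₅.reg 2 = I.m :=
    (run_reg rfl s₄).trans ((run_reg rfl s₃).trans ((run_reg rfl s₂).trans m₂))
  have input₅ : s₅.arr 0 = s₁.arr 0 := (run_arr rfl s₄).trans ((run_arr rfl s₃).trans input₃)
  have off₅ : s₅.arr 7 = s₃.arr 7 := (run_arr rfl s₄).trans (run_arr rfl s₃)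
  have cand₅ : ∀ (i : Fin I.n) (q : Fin I.m),
      s₅.arr 0 (s₅.arr 7 i + q) = ((I.V i).symm q : ℕ) := by
    intro i q
    rw [off₅, off₃ i (by omega), input₅, input₁, getD_encode_candidate]
  have pos₆ : ∀ i < s₅.reg 0, ∀ c < s₅.reg 0, i < I.n → c < I.m →
      (positionCmd.run s₅).arr 4 (s₅.reg 0 * i + c) = I.position i c := by
    refine fill_spec (by decide) (by decide) (by decide) rfl rfl rfl rfl
      (fun i c v => i < I.n → c < I.m → v = I.position i c) ?_
    intro i _ c _ s' hx hy hr ha hi hc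
    have h0 : s'.reg 0 = s₅.reg 0 := hr 0 (by decide) (by decide) rfl
    have h2 : s'.reg 2 = I.m := (hr 2 (by decide) (by decide) rfl).trans m₅
    have ha0 : s'.arr 0 = s₅.arr 0 := ha 0 (by decide) rfl
    have ha7 : s'.arr 7 = s₅.arr 7 := ha 7 (by decide) rfl
    have hp : I.position i c = (I.V ⟨i, hi⟩ ⟨c, hc⟩ : ℕ) := position_coe ⟨i, hi⟩ ⟨c, hc⟩
    rw [hp]
    refine searchCmd_spec hx hy (by omega) (by rw [h2]; exact Fin.isLt _) ?_ ?_
    · rw [ha0, ha7]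
      have := cand₅ ⟨i, hi⟩ (I.V ⟨i, hi⟩ ⟨c, hc⟩)
      simpa using this
    · intro r hr' hrc
      rw [h2] at hr'
      rw [ha0, ha7] at hrc
      have h1 := (cand₅ ⟨i, hi⟩ ⟨r, hr'⟩).symm.trans hrc
      have h3 : (I.V ⟨i, hi⟩).symm ⟨r, hr'⟩ = ⟨c, hc⟩ := Fin.ext h1
      rw [← h3, Equiv.apply_symm_apply]
  rw [hrun]
  have L₆ : (positionCmd.run s₅).reg 0 = s₅.reg 0 := run_reg rfl s₅
  have up : ∀ z, majorityCmd.writesReg z = false → offsetCmd.writesReg z = false →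
      infinityCmd.writesReg z = false → powerCmd.writesReg z = false →
      positionCmd.writesReg z = false → (positionCmd.run s₅).reg z = s₁.reg z := by
    intro z a b c d e
    rw [run_reg e, hs₅, run_reg d, hs₄, run_reg c, hs₃, run_reg b, hs₂, run_reg a]
  refine ⟨L₆.trans len₅, (up 1 rfl rfl rfl rfl rfl).trans n₁, (up 2 rfl rfl rfl rfl rfl).trans m₁,
    (up 3 rfl rfl rfl rfl rfl).trans p₁, ?_, ?_, (up 9 rfl rfl rfl rfl rfl).trans r₁, ?_, ?_, ?_, ?_⟩
  · rw [run_reg rfl, hs₅, run_reg rfl, hs₄, run_reg rfl, hs₃, run_reg rfl, maj₂]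
  · rw [run_reg rfl, hs₅, run_reg rfl, inf₄]
  · intro j
    rw [run_arr rfl, input₅, input₁]
  · intro i hi c hc
    rw [L₆]
    exact pos₆ i (by omega) c (by omega) hi hc
  · intro i hi
    rw [L₆] at hi ⊢
    rw [run_arr rfl, pow₅ i (by omega), len₄, len₅]
  · intro i hi
    rw [L₆] at hi
    rw [run_arr rfl, off₅, off₃ i (by omega)]

end ShiftBribery

end Bucklin

namespace Bucklin

open RAM RAM.Cmd

namespace ShiftBribery

/-! ### Minimizing a weight -/

variable (I : ShiftBribery) {s : State}

/-- `v` is the minimum total weight of a successful shift action. -/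
def IsMinWeight (w : ℕ → ℕ → ℕ) (v : ℕ) : Prop :=
  (∃ T : I.Action, I.Succeeds T ∧ I.totalWeight w T = v) ∧
    ∀ T : I.Action, I.Succeeds T → v ≤ I.totalWeight w T

/-- Compute the minimum weight in register `7`. -/
def solveCmd : Cmd := seq DP.penaltyCmd DP.minimizeCmd

variable {I}

/-- The program changes nothing of the prepared instance. -/
def keepsSetup (c : Cmd) : Bool :=
  !(c.writesReg 0 || c.writesReg 1 || c.writesReg 2 || c.writesReg 3 || c.writesReg 4 ||
    c.writesReg 5 || c.writesReg 9 || c.writesArr 0 || c.writesArr 4 || c.writesArr 5 ||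
    c.writesArr 7)

theorem Setup.run {c : Cmd} (h : I.Setup s) (hc : keepsSetup c = true) : I.Setup (c.run s) := by
  simp only [keepsSetup, Bool.not_eq_true', Bool.or_eq_false_iff] at hc
  obtain ⟨⟨⟨⟨⟨⟨⟨⟨⟨⟨c0, c1⟩, c2⟩, c3⟩, c4⟩, c5⟩, c9⟩, d0⟩, d4⟩, d5⟩, d7⟩ := hc
  obtain ⟨a1, a2, a3, a4, a5, a6, a7, a8, a9, a10, a11⟩ := h
  constructor <;>
    simpa only [run_reg c0 s, run_reg c1 s, run_reg c2 s, run_reg c3 s, run_reg c4 s,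
      run_reg c5 s, run_reg c9 s, run_arr d0 s, run_arr d4 s, run_arr d5 s, run_arr d7 s]

/-- The penalty exceeds the sum of the whole `L` by `L` table of weights, while an action uses one
entry from each of `n` rows; entries without meaning can only enlarge the penalty. -/
theorem solveCmd_spec (hs : I.Setup s) {w : ℕ → ℕ → ℕ}
    (hw : ∀ i < I.n, ∀ t ≤ I.m, s.arr 1 (s.reg 0 * i + t) = w i t) :
    I.IsMinWeight w ((solveCmd.run s).reg 7) := by
  have hn := I.n_lt_length
  have hm := I.m_lt_length
  set pen := 1 + ∑ i ∈ Finset.range (s.reg 0), ∑ t ∈ Finset.range (s.reg 0),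
    s.arr 1 (s.reg 0 * i + t) with hpen
  have h1 : I.Setup (DP.penaltyCmd.run s) := hs.run rfl
  have hlen := hs.len
  have h0 : (DP.penaltyCmd.run s).reg 0 = s.reg 0 := run_reg rfl s
  have hE : DP.Env (I.data 0 w pen) (DP.penaltyCmd.run s) :=
    { reg1 := h1.reg1
      reg2 := h1.reg2
      reg3 := h1.reg3
      reg4 := h1.reg4
      reg6 := DP.penaltyCmd_spec
      reg9 := h1.reg9
      pos := h1.pos
      w := fun i hi t ht => by rw [run_arr rfl, h0]; exact hw i hi t ht
      n_le := by rw [h0, hlen]; exact hn.le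
      m_lt := by rw [h0, hlen]; exact hm.le
      maj_lt := by rw [h0, hlen]; exact (majority_le I.n_pos).trans_lt hn
      p_lt := I.p.isLt }
  have hval : (solveCmd.run s).reg 7 = I.minValue w pen := DP.minimizeCmd_spec hE
  have hlt : ∀ T : I.Action, I.totalWeight w T < pen := by
    intro T
    rw [totalWeight_eq_sum, hpen, add_comm, Nat.lt_add_one_iff]
    calc ∑ j ∈ Finset.range I.n, w j (Action.toFun T j)
        ≤ ∑ j ∈ Finset.range I.n, ∑ t ∈ Finset.range (s.reg 0), s.arr 1 (s.reg 0 * j + t) := by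
          refine Finset.sum_le_sum fun j hj => ?_
          rw [Finset.mem_range] at hj
          have hT : Action.toFun T j ≤ I.m := by
            rw [Action.toFun, dif_pos hj]; exact Nat.le_of_lt_succ (Fin.isLt _)
          rw [← hw j hj _ hT]
          exact Finset.single_le_sum (f := fun t => s.arr 1 (s.reg 0 * j + t))
            (fun _ _ => Nat.zero_le _) (Finset.mem_range.2 (by omega))
      _ ≤ _ := Finset.sum_le_sum_of_subset (Finset.range_mono (by omega))
  rw [hval]
  exact ⟨exists_minValue hlt, fun T hT => minValue_le w pen hT⟩

/-! ### The weights -/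

variable (I) in
/-- The costs of the shifts, with infinite costs replaced. -/
noncomputable def costWeight (i t : ℕ) : ℕ :=
  finiteCost I.bigCost (I.encode.getD (3 + i * (I.m + I.m + 1) + I.m + t) 0)

/-- Read a cost. -/
def readCostCmd : Cmd :=
  seq (assign 20 (.load 0 (.add (.add (.load 7 (.reg 10)) (.reg 2)) (.reg 11))))
    (ite (.reg 20) (assign 20 (.sub (.reg 20) (.const 1))) (assign 20 (.reg 5)))

theorem readCostCmd_spec {i t : ℕ} (hs : I.Setup s) (hi : s.reg 10 = i) (ht : s.reg 11 = t)
    (hiL : i < s.reg 0) : (readCostCmd.run s).reg 20 = I.costWeight i t := by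
  have h : s.arr 0 (s.arr 7 i + s.reg 2 + t) =
      I.encode.getD (3 + i * (I.m + I.m + 1) + I.m + t) 0 := by
    rw [hs.input, hs.offset i hiL, hs.reg2]
  rw [costWeight, finiteCost, ← h]
  simp only [readCostCmd, Cmd.run, Expr.eval, hi, ht]
  simp only [State.setReg, Function.update_self]
  split_ifs
  · rfl
  · simpa using hs.reg5

/-- Write the costs into the table of weights. -/
def costWeightCmd : Cmd := fill 10 11 1 readCostCmd (.reg 20)

/-- Lexicographic refinement of a cost by the shift itself. -/
def codeWeightPre : Cmd :=
  seq readCostCmd (seq (forN 12 0 (assign 20 (.mul (.reg 0) (.reg 20))))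
    (forN 12 11 (assign 20 (.add (.reg 20)
      (.load 5 (.sub (.sub (.reg 0) (.const 1)) (.reg 10)))))))

/-- Write the refined costs into the table of weights. -/
def codeWeightCmd : Cmd := fill 10 11 1 codeWeightPre (.reg 20)

theorem Setup.congr {s' : State} (h : I.Setup s) (h0 : s'.reg 0 = s.reg 0)
    (h1 : s'.reg 1 = s.reg 1) (h2 : s'.reg 2 = s.reg 2) (h3 : s'.reg 3 = s.reg 3)
    (h4 : s'.reg 4 = s.reg 4) (h5 : s'.reg 5 = s.reg 5) (h9 : s'.reg 9 = s.reg 9)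
    (ha0 : s'.arr 0 = s.arr 0) (ha4 : s'.arr 4 = s.arr 4) (ha5 : s'.arr 5 = s.arr 5)
    (ha7 : s'.arr 7 = s.arr 7) : I.Setup s' := by
  obtain ⟨a1, a2, a3, a4, a5, a6, a7, a8, a9, a10, a11⟩ := h
  constructor <;> simpa only [h0, h1, h2, h3, h4, h5, h9, ha0, ha4, ha5, ha7]

theorem costWeightCmd_spec (hs : I.Setup s) : ∀ i < s.reg 0, ∀ t < s.reg 0,
    (costWeightCmd.run s).arr 1 (s.reg 0 * i + t) = I.costWeight i t := by
  refine fill_spec (by decide) (by decide) (by decide) rfl rfl rfl rfl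
    (fun i t v => v = I.costWeight i t) ?_
  intro i hi t _ s' hx hy hr ha
  have h0 : s'.reg 0 = s.reg 0 := hr 0 (by decide) (by decide) rfl
  exact readCostCmd_spec (hs.congr h0 (hr 1 (by decide) (by decide) rfl)
    (hr 2 (by decide) (by decide) rfl) (hr 3 (by decide) (by decide) rfl)
    (hr 4 (by decide) (by decide) rfl) (hr 5 (by decide) (by decide) rfl)
    (hr 9 (by decide) (by decide) rfl) (ha 0 (by decide) rfl) (ha 4 (by decide) rfl)
    (ha 5 (by decide) rfl) (ha 7 (by decide) rfl)) hx hy (by omega)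

/-- Multiplying by `L` in `L` rounds respects the restriction on products; `L ^ L` has only
polynomially many bits. -/
theorem mulPow_spec {x : ℕ} (hx : x ≠ 0) (hx12 : x ≠ 12) :
    ((forN 12 0 (assign x (.mul (.reg 0) (.reg x)))).run s).reg x =
      s.reg x * s.reg 0 ^ s.reg 0 := by
  refine forN_induction (s := s) (N := s.reg 0) (r := 0) (x := 12) rfl le_rfl (by decide)
    (by simp [writesReg, hx])
    (fun k s' => s'.reg x = s.reg x * s.reg 0 ^ k)
    (fun k s' v hk => by simpa [State.setReg, hx12] using hk) (by simp) ?_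
  intro k _ s' _ hf hI
  have h0 : s'.reg 0 = s.reg 0 := hf.reg 0 (by decide) (by simp [writesReg, hx])
  simp only [Cmd.run, Expr.eval, State.setReg, Function.update_self, h0, hI]
  ring

variable (I) in
/-- The refined costs. -/
noncomputable def codeWeight (i t : ℕ) : ℕ :=
  I.costWeight i t * I.encode.length ^ I.encode.length +
    t * I.encode.length ^ (I.encode.length - 1 - i)

theorem codeWeightPre_spec {i t : ℕ} (hs : I.Setup s) (hi : s.reg 10 = i) (ht : s.reg 11 = t)
    (hiL : i < s.reg 0) (htL : t < s.reg 0) :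
    (codeWeightPre.run s).reg 20 = I.codeWeight i t := by
  set s₁ := readCostCmd.run s with hs₁
  set s₂ := (forN 12 0 (assign 20 (.mul (.reg 0) (.reg 20)))).run s₁ with hs₂
  have h0₁ : s₁.reg 0 = s.reg 0 := run_reg rfl s
  have h0₂ : s₂.reg 0 = s.reg 0 := (run_reg rfl s₁).trans h0₁
  have h11₂ : s₂.reg 11 = t := (run_reg rfl s₁).trans ((run_reg rfl s).trans ht)
  have h10₂ : s₂.reg 10 = i := (run_reg rfl s₁).trans ((run_reg rfl s).trans hi)
  have ha₂ : s₂.arr 5 = s.arr 5 := (run_arr rfl s₁).trans (run_arr rfl s)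
  have h20₁ : s₁.reg 20 = I.costWeight i t := readCostCmd_spec hs hi ht hiL
  have h20₂ : s₂.reg 20 = I.costWeight i t * I.encode.length ^ I.encode.length := by
    rw [hs₂, mulPow_spec (by decide) (by decide), h20₁, h0₁, hs.len]
  have hrun : codeWeightPre.run s = (forN 12 11 (assign 20 (.add (.reg 20)
    (.load 5 (.sub (.sub (.reg 0) (.const 1)) (.reg 10)))))).run s₂ := rfl
  rw [hrun]
  refine forN_induction (s := s₂) (N := t) (r := 11) (x := 12) h11₂ (by omega) (by decide) rfl
    (fun k s' => s'.reg 20 = I.costWeight i t * I.encode.length ^ I.encode.length +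
      k * I.encode.length ^ (I.encode.length - 1 - i))
    (fun k s' v hk => by simpa [State.setReg] using hk) (by simpa using h20₂) ?_
  intro k _ s' _ hf hI
  have h0 : s'.reg 0 = s.reg 0 := (hf.reg 0 (by decide) rfl).trans h0₂
  have h10 : s'.reg 10 = i := (hf.reg 10 (by decide) rfl).trans h10₂
  have ha : s'.arr 5 = s.arr 5 := (hf.arr 5 rfl).trans ha₂
  simp only [Cmd.run, Expr.eval, State.setReg, Function.update_self, h0, h10, ha, hI]
  rw [hs.power _ (by omega), hs.len]
  ring

theorem codeWeightCmd_spec (hs : I.Setup s) : ∀ i < s.reg 0, ∀ t < s.reg 0,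
    (codeWeightCmd.run s).arr 1 (s.reg 0 * i + t) = I.codeWeight i t := by
  refine fill_spec (by decide) (by decide) (by decide) rfl rfl rfl rfl
    (fun i t v => v = I.codeWeight i t) ?_
  intro i hi t ht s' hx hy hr ha
  have h0 : s'.reg 0 = s.reg 0 := hr 0 (by decide) (by decide) rfl
  exact codeWeightPre_spec (hs.congr h0 (hr 1 (by decide) (by decide) rfl)
    (hr 2 (by decide) (by decide) rfl) (hr 3 (by decide) (by decide) rfl)
    (hr 4 (by decide) (by decide) rfl) (hr 5 (by decide) (by decide) rfl)
    (hr 9 (by decide) (by decide) rfl) (ha 0 (by decide) rfl) (ha 4 (by decide) rfl)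
    (ha 5 (by decide) rfl) (ha 7 (by decide) rfl)) hx hy (by omega) (by omega)

/-! ### Codes of shift actions -/

/-- The number with the digits `t k, …, t (k + d - 1)` at the places `L - 1 - k, …`. -/
def code (L : ℕ) (t : ℕ → ℕ) : ℕ → ℕ → ℕ
  | _, 0 => 0
  | k, d + 1 => t k * L ^ (L - 1 - k) + code L t (k + 1) d

theorem code_lt {L : ℕ} {t : ℕ → ℕ} {k d : ℕ} (hL : 0 < L)
    (ht : ∀ i < k + d, t i < L) (hk : k + d ≤ L) : code L t k d < L ^ (L - k) := by
  induction d generalizing k with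
  | zero => exact Nat.pow_pos hL
  | succ d ih =>
    have h1 := ih (k := k + 1) (fun i hi => ht i (by omega)) (by omega)
    rw [code, show L - k = L - 1 - k + 1 by omega, pow_succ']
    rw [show L - (k + 1) = L - 1 - k by omega] at h1
    have h2 := Nat.mul_le_mul_right (L ^ (L - 1 - k)) (Nat.succ_le_of_lt (ht k (by omega)))
    rw [Nat.succ_mul] at h2
    omega

theorem code_eq_sum (L : ℕ) (t : ℕ → ℕ) (k d : ℕ) :
    code L t k d = ∑ i ∈ Finset.range d, t (k + i) * L ^ (L - 1 - (k + i)) := by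
  induction d generalizing k with
  | zero => rfl
  | succ d ih =>
    rw [code, ih, Finset.sum_range_succ', add_comm]
    simp only [add_zero, add_assoc, add_comm 1]

/-- Extract one digit into register `20`. -/
def digitCmd : Cmd :=
  seq (assign 20 (.const 0)) (seq (assign 21 (.load 5 (.sub (.sub (.reg 0) (.const 1)) (.reg 10))))
    (forN 12 0 (ite (.sub (.add (.reg 26) (.const 1)) (.reg 21))
      (seq (assign 26 (.sub (.reg 26) (.reg 21))) (assign 20 (.add (.reg 20) (.const 1)))) skip)))

/-- Write the digits of the code in register `26`. -/
def decodeCmd : Cmd := forN 10 1 (seq digitCmd (write (.reg 20)))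

/-- Division by repeated subtraction: a digit is below `L`, so `L` rounds suffice, and the surplus
rounds do nothing because `R < P`. -/
theorem digitCmd_spec {i d P R : ℕ} (hi : s.reg 10 = i) (hP : s.arr 5 (s.reg 0 - 1 - i) = P)
    (hd : d < s.reg 0) (h26 : s.reg 26 = d * P + R) (hR : R < P) :
    (digitCmd.run s).reg 20 = d ∧ (digitCmd.run s).reg 26 = R := by
  set s₁ := (seq (assign 20 (.const 0))
    (assign 21 (.load 5 (.sub (.sub (.reg 0) (.const 1)) (.reg 10))))).run s with hs₁
  have h0₁ : s₁.reg 0 = s.reg 0 := run_reg rfl s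
  have h21₁ : s₁.reg 21 = P := by
    simp [hs₁, Cmd.run, Expr.eval, State.setReg, hi, hP]
  have h26₁ : s₁.reg 26 = d * P + R := (run_reg rfl s).trans h26
  have h20₁ : s₁.reg 20 = 0 := by simp [hs₁, Cmd.run, Expr.eval, State.setReg]
  have hrun : digitCmd.run s = (forN 12 0 (ite (.sub (.add (.reg 26) (.const 1)) (.reg 21))
      (seq (assign 26 (.sub (.reg 26) (.reg 21))) (assign 20 (.add (.reg 20) (.const 1))))
        skip)).run s₁ := rfl
  rw [hrun]
  have key := forN_induction (s := s₁) (N := s.reg 0) (r := 0) (x := 12)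
    (c := ite (.sub (.add (.reg 26) (.const 1)) (.reg 21))
      (seq (assign 26 (.sub (.reg 26) (.reg 21))) (assign 20 (.add (.reg 20) (.const 1)))) skip)
    h0₁ h0₁.ge (by decide) rfl
    (fun k s' => s'.reg 20 = min k d ∧ s'.reg 26 = (d - min k d) * P + R)
    (fun k s' v hk => by simpa [State.setReg] using hk) (by simp [h20₁, h26₁]) ?_
  · rwa [min_eq_right hd.le, Nat.sub_self, zero_mul, zero_add] at key
  · intro k _ s' _ hf hI
    have h21 : s'.reg 21 = P := (hf.reg 21 (by decide) rfl).trans h21₁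
    obtain ⟨h20, h26⟩ := hI
    rw [Cmd.run]
    simp only [Expr.eval, h21]
    by_cases hk : k < d
    · rw [min_eq_left hk.le] at h20 h26
      rw [min_eq_left (by omega)]
      have hsplit : d - k = d - (k + 1) + 1 := by omega
      rw [hsplit, add_one_mul] at h26
      rw [if_pos (by omega)]
      simp only [Cmd.run, Expr.eval, State.setReg, Function.update_self, h21]
      refine ⟨by simp [h20], ?_⟩
      rw [Function.update_of_ne (by decide), Function.update_self, h26]
      omega
    · rw [min_eq_right (by omega), Nat.sub_self, zero_mul, zero_add] at h26
      rw [min_eq_right (by omega)] at h20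
      rw [min_eq_right (by omega), if_neg (by omega), Nat.sub_self, zero_mul, zero_add]
      exact ⟨h20, h26⟩

theorem decodeCmd_spec {t : ℕ → ℕ} (hs : I.Setup s) (ht : ∀ i < I.n, t i < s.reg 0)
    (h26 : s.reg 26 = code (s.reg 0) t 0 I.n) (hout : s.out = []) :
    (decodeCmd.run s).out = (List.range I.n).map t := by
  have hn : I.n < s.reg 0 := by rw [hs.len]; exact I.n_lt_length
  refine (forN_induction (s := s) (N := I.n) (r := 1) (x := 10) hs.reg1 hn.le (by decide) rfl
    -- After `k` digits, register `26` holds the code of the remaining ones, which `code_lt` keeps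
    -- below the place value of the digit just removed.
    (fun k s' => s'.out = (List.range k).map t ∧ s'.reg 26 = code (s.reg 0) t k (I.n - k))
    (fun k s' v hk => by simpa [State.setReg] using hk) ⟨hout, h26⟩ ?_).1
  intro k hk s' hx hf ⟨ho, hI⟩
  have h0 : s'.reg 0 = s.reg 0 := hf.reg 0 (by decide) rfl
  have ha : s'.arr 5 = s.arr 5 := hf.arr 5 rfl
  have hlt := code_lt (L := s.reg 0) (t := t) (k := k + 1) (d := I.n - (k + 1)) (by omega)
    (fun i hi => ht i (by omega)) (by omega)
  rw [show s.reg 0 - (k + 1) = s.reg 0 - 1 - k by omega] at hlt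
  rw [show I.n - k = I.n - (k + 1) + 1 by omega, code] at hI
  obtain ⟨h20, h26'⟩ := digitCmd_spec (s := s') (d := t k)
    (R := code (s.reg 0) t (k + 1) (I.n - (k + 1))) hx
    (by rw [ha, h0]; exact hs.power _ (by omega)) (by rw [h0]; exact ht k hk) hI hlt
  refine ⟨?_, h26'⟩
  have ho' : (digitCmd.run s').out = s'.out := run_out rfl s'
  rw [Cmd.run, Cmd.run, State.append]
  simp only [Expr.eval, h20, ho', ho, List.range_succ, List.map_append, List.map_cons,
    List.map_nil]

/-! ### The algorithm -/

theorem totalWeight_codeWeight (T : I.Action) :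
    I.totalWeight I.codeWeight T =
      I.totalWeight I.costWeight T * I.encode.length ^ I.encode.length +
        code I.encode.length (Action.toFun T) 0 I.n := by
  rw [totalWeight_eq_sum, totalWeight_eq_sum, code_eq_sum, Finset.sum_mul,
    ← Finset.sum_add_distrib]
  simp only [zero_add]
  rfl

theorem Action.toFun_lt (T : I.Action) (i : ℕ) : Action.toFun T i < I.encode.length := by
  have := I.m_lt_length
  unfold Action.toFun
  split_ifs with h
  · have := (T ⟨i, h⟩).isLt; omega
  · omega

/-- Codes are below `L ^ L`, so the refined weight orders actions by cost first. Its minimizer `T`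
therefore has minimal cost `v`, and subtracting `v * L ^ L` leaves exactly the code of `T`. -/
theorem exists_optimal_of_isMinWeight {v v' : ℕ} (h : I.IsMinWeight I.costWeight v)
    (h' : I.IsMinWeight I.codeWeight v') :
    ∃ T, I.IsOptimal T ∧ v' - v * I.encode.length ^ I.encode.length =
      code I.encode.length (Action.toFun T) 0 I.n := by
  obtain ⟨⟨S, hS, hSv⟩, hmin⟩ := h
  obtain ⟨⟨T, hT, hTv⟩, hmin'⟩ := h'
  have hL : 0 < I.encode.length := by have := I.n_lt_length; omega
  have hcode := code_lt (L := I.encode.length) (t := Action.toFun S) (k := 0) (d := I.n) hL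
    (fun i _ => Action.toFun_lt S i) (by have := I.n_lt_length; omega)
  have h1 := hmin' S hS
  rw [totalWeight_codeWeight, hSv] at h1
  rw [totalWeight_codeWeight] at hTv
  rw [Nat.sub_zero] at hcode
  have hTw : I.totalWeight I.costWeight T = v := by
    refine le_antisymm ?_ (hmin T hT)
    -- A cost of at least `v + 1` would give refined weight at least `(v + 1) * L ^ L`, more than
    -- that of `S`.
    by_contra hlt
    have h2 := Nat.mul_le_mul_right (I.encode.length ^ I.encode.length)
      (Nat.succ_le_of_lt (not_le.1 hlt))
    rw [Nat.succ_mul] at h2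
    omega
  refine ⟨T, ?_, by rw [hTw] at hTv; omega⟩
  refine isOptimal_of_finiteCost (M := I.bigCost) (w := I.costWeight) ?_ ?_ hT fun R hR => ?_
  · have := I.sum_costCode_le
    unfold bigCost
    omega
  · intro i j
    rw [costWeight, getD_encode_cost]
  · rw [hTw]; exact hmin R hR

/-- The algorithm for shift bribery. -/
def algorithm : Cmd :=
  seq setupCmd (seq costWeightCmd (seq solveCmd (seq (assign 25 (.reg 7))
    (seq (forN 12 0 (assign 25 (.mul (.reg 0) (.reg 25)))) (seq codeWeightCmd (seq solveCmd
      (seq (assign 26 (.sub (.reg 7) (.reg 25))) decodeCmd)))))))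

theorem algorithm_spec (I : ShiftBribery) :
    I.IsAnswer (algorithm.run (init I.encode)).out := by
  have hn := I.n_lt_length
  have hm := I.m_lt_length
  obtain ⟨s₁, hs₁⟩ : ∃ x, x = setupCmd.run (init I.encode) := ⟨_, rfl⟩
  obtain ⟨s₂, hs₂⟩ : ∃ x, x = costWeightCmd.run s₁ := ⟨_, rfl⟩
  obtain ⟨s₃, hs₃⟩ : ∃ x, x = solveCmd.run s₂ := ⟨_, rfl⟩
  obtain ⟨s₄, hs₄⟩ : ∃ x, x = (assign 25 (.reg 7)).run s₃ := ⟨_, rfl⟩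
  obtain ⟨s₅, hs₅⟩ : ∃ x, x = (forN 12 0 (assign 25 (.mul (.reg 0) (.reg 25)))).run s₄ := ⟨_, rfl⟩
  obtain ⟨s₆, hs₆⟩ : ∃ x, x = codeWeightCmd.run s₅ := ⟨_, rfl⟩
  obtain ⟨s₇, hs₇⟩ : ∃ x, x = solveCmd.run s₆ := ⟨_, rfl⟩
  obtain ⟨s₈, hs₈⟩ : ∃ x, x = (assign 26 (.sub (.reg 7) (.reg 25))).run s₇ := ⟨_, rfl⟩
  have hrun : algorithm.run (init I.encode) = decodeCmd.run s₈ := by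
    subst hs₈ hs₇ hs₆ hs₅ hs₄ hs₃ hs₂ hs₁; rfl
  have S₁ : I.Setup s₁ := hs₁ ▸ I.setupCmd_spec
  have S₂ : I.Setup s₂ := hs₂ ▸ S₁.run rfl
  have S₃ : I.Setup s₃ := hs₃ ▸ S₂.run rfl
  have S₄ : I.Setup s₄ := hs₄ ▸ S₃.run rfl
  have S₅ : I.Setup s₅ := hs₅ ▸ S₄.run rfl
  have S₆ : I.Setup s₆ := hs₆ ▸ S₅.run rfl
  have S₇ : I.Setup s₇ := hs₇ ▸ S₆.run rfl
  have S₈ : I.Setup s₈ := hs₈ ▸ S₇.run rfl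
  have h1 : I.IsMinWeight I.costWeight (s₃.reg 7) := by
    rw [hs₃]
    refine solveCmd_spec S₂ fun i hi t ht => ?_
    rw [S₂.len, ← S₁.len, hs₂]
    exact costWeightCmd_spec S₁ i (by rw [S₁.len]; omega) t (by rw [S₁.len]; omega)
  have h2 : I.IsMinWeight I.codeWeight (s₇.reg 7) := by
    rw [hs₇]
    refine solveCmd_spec S₆ fun i hi t ht => ?_
    rw [S₆.len, ← S₅.len, hs₆]
    exact codeWeightCmd_spec S₅ i (by rw [S₅.len]; omega) t (by rw [S₅.len]; omega)
  obtain ⟨T, hT, hcode⟩ := exists_optimal_of_isMinWeight h1 h2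
  have h25₅ : s₅.reg 25 = s₃.reg 7 * I.encode.length ^ I.encode.length := by
    rw [hs₅, mulPow_spec (by decide) (by decide), S₄.len, hs₄]
    rfl
  have h25 : s₇.reg 25 = s₅.reg 25 := by rw [hs₇, run_reg rfl, hs₆, run_reg rfl]
  have h26 : s₈.reg 26 = code (s₈.reg 0) (Action.toFun T) 0 I.n := by
    rw [S₈.len, ← hcode, ← h25₅, ← h25, hs₈]
    rfl
  have hout : s₈.out = [] := by
    rw [hs₈, run_out rfl, hs₇, run_out rfl, hs₆, run_out rfl, hs₅, run_out rfl, hs₄, run_out rfl,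
      hs₃, run_out rfl, hs₂, run_out rfl, hs₁, run_out rfl]
    rfl
  refine ⟨T, hT, ?_⟩
  rw [hrun, decodeCmd_spec S₈ (fun i _ => by rw [S₈.len]; exact Action.toFun_lt T i) h26 hout]
  refine List.ext_getElem (by simp) fun i h _ => ?_
  rw [List.length_map, List.length_range] at h
  rw [List.getElem_map, List.getElem_range, List.getElem_ofFn]
  simp [Action.toFun, h]

end ShiftBribery

end Bucklin

/-- Well-formedness of the algorithm, and with it the time bound, is checked by evaluation. -/
theorem theorem1 :
    RAM.SolvableInPolyTime Bucklin.ShiftBribery.encode Bucklin.ShiftBribery.IsAnswer :=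
  RAM.solvableInPolyTime_of_cmd Bucklin.ShiftBribery.algorithm rfl
    Bucklin.ShiftBribery.algorithm_spec
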